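/- Let $T_1,T_2,\dots$ be i.i.d. random variables on a probability space $(\mathcal S,\mathfrak S,\mathsf P)$ with values in $\{1,2,\dots\}$, such that for all $t\in\{1,2,\dots\}$ $$\mathsf P[T_1=t]=\frac{\ell(t)}{t^{\alpha+1}}>0,$$ where $\alpha\ge 1$ and $\ell:[1,+\infty)\to\mathbb R$ is slowly varying at infinity, i.e. $\ell$ is measurable, $\ell(z)>0$ for all sufficiently large $z$, and $\lim_{z\to+\infty}\ell(\lambda z)/\ell(z)=1$ for every $\lambda>0$. Put $S_0:=0$, $S_i:=T_1+\dots+T_i$, and $L_n:=\sup\{i\ge 0: S_i\le n\}$. Let $\omega=(\omega_a)_{a\ge 0}$ (the charges) be a sequence of i.i.d. real random variables on a probability space with expectation $\mathbb E$, such that $\mathbb E[\mathrm e^{\eta|\omega_0|}]<+\infty$ for some $\eta>0$, $\mathbb E[\omega_0]=0$ and $\mathbb E[\omega_0^2]>0$. For $n\ge 0$ and $h\in\mathbb R$ let $$Z_{n,h}(\omega):=\mathsf E\Big[\mathrm e^{\sum_{i=1}^{L_n}(h+\omega_{S_i})}\,\mathbf 1_{\{\exists\, i\ge 0:\ S_i=n\}}\Big],$$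 where $\mathsf E$ is the expectation over $T_1,T_2,\dots$ only, with $\omega$ fixed. Then for every $h\in\mathbb R$ the variables $\frac1n\log Z_{n,h}$, $n\ge 1$, are integrable and the limit (the free energy) $$f(h):=\lim_{n\to\infty}\mathbb E\Big[\frac1n\log Z_{n,h}\Big]$$ exists and is finite. Let $h_c:=\inf\{h\in\mathbb R: f(h)>0\}\in[-\infty,+\infty]$. If $h_c>-\infty$, then $h_c$ is finite and there exists a constant $c>0$ such that, for all sufficiently small $\delta>0$, $$f(h_c+\delta)\le c\,\delta^2 .$$ -/

import Mathlib

open MeasureTheory ProbabilityTheory Filter Topology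

namespace Pinning

/-- A real function `ℓ`, of which only the values on `[1, +∞)` matter, is slowly varying at
infinity: it is measurable on `[1, +∞)`, eventually positive, and `ℓ (l * z) / ℓ z → 1` as
`z → +∞` for every `l > 0`. -/
def SlowlyVarying (ℓ : ℝ → ℝ) : Prop :=
  Measurable (fun z : Set.Ici (1 : ℝ) => ℓ z) ∧
  (∀ᶠ z in atTop, 0 < ℓ z) ∧
  ∀ l : ℝ, 0 < l → Tendsto (fun z : ℝ => ℓ (l * z) / ℓ z) atTop (𝓝 1)

section

variable {S Ω : Type*} [MeasurableSpace S] [MeasurableSpace Ω]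

/-- The renewal times `S₀ = 0`, `S_i = T₁ + ⋯ + T_i`. The sequence of inter-arrival times is
indexed from `0`: `T j` stands for the inter-arrival time with number `j + 1`. -/
def renewalTime (T : ℕ → S → ℕ) (i : ℕ) (s : S) : ℕ :=
  ∑ j ∈ Finset.range i, T j s

/-- The number `L_n = sup {i : S_i ≤ n}` of renewals by time `n`. The set is bounded (by `n`)
when the inter-arrival times are at least `1`. -/
noncomputable def contactNumber (T : ℕ → S → ℕ) (n : ℕ) (s : S) : ℕ :=
  sSup {i : ℕ | renewalTime T i s ≤ n}

/-- The event `{n ∈ S}` that a renewal time coincides with `n`. -/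
def renewalEvent (T : ℕ → S → ℕ) (n : ℕ) : Set S :=
  {s | ∃ i : ℕ, renewalTime T i s = n}

/-- The partition function
`Z_{n,h}(w) = E[exp (∑_{i=1}^{L_n} (h + w_{S_i})) 1_{n ∈ S}]` with charges `w`. -/
noncomputable def partitionFunction (P : Measure S) (T : ℕ → S → ℕ) (n : ℕ) (h : ℝ)
    (w : ℕ → ℝ) : ℝ :=
  ∫ s, (renewalEvent T n).indicator
    (fun s => Real.exp (∑ i ∈ Finset.Icc 1 (contactNumber T n s), (h + w (renewalTime T i s)))) s ∂P

/-- The finite-volume free energy density `(1/n) log Z_{n,h}`, as a random variable of the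
charges `ω`. -/
noncomputable def freeEnergyAt (P : Measure S) (T : ℕ → S → ℕ) (ω : ℕ → Ω → ℝ) (n : ℕ) (h : ℝ)
    (x : Ω) : ℝ :=
  1 / (n : ℝ) * Real.log (partitionFunction P T n h (fun a => ω a x))

/-- The free energy density `f(h) = lim_n 𝔼[(1/n) log Z_{n,h}]`. -/
noncomputable def freeEnergy (P : Measure S) (T : ℕ → S → ℕ) (Q : Measure Ω) (ω : ℕ → Ω → ℝ)
    (h : ℝ) : ℝ :=
  limUnder atTop (fun n : ℕ => ∫ x, freeEnergyAt P T ω n h x ∂Q)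

/-- The critical point `h_c = inf {h ∈ ℝ : f(h) > 0}`, an extended real number. -/
noncomputable def criticalPoint (P : Measure S) (T : ℕ → S → ℕ) (Q : Measure Ω)
    (ω : ℕ → Ω → ℝ) : EReal :=
  sInf ((fun h : ℝ => (h : EReal)) '' {h : ℝ | 0 < freeEnergy P T Q ω h})

end

end Pinning

/-! The argument is a rare-stretch strategy combined with a change of measure on the charges. Let
`h` be a reward with nonpositive free energy. The mean of `log Z` is superadditive in `n`, so the
free energy is the supremum of its finite-volume values, and `E[log Z_{n,h}] ≤ 0` for every `n`.

Tilt the law `μ` of a charge by the density `1 + δ φ`, where `φ` is the centered indicator of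
positive values. The relative entropy per site is at most `δ²` (`integral_log_tiltDensity_le`), yet
the tilt raises the mean of `log Z` at least as much as increasing `h` by `cδ`
(`exists_meanLogSum_shift_le`). The comparison goes site by site: as a function of one charge, `Z =
A + B exp x`, which reduces everything to the one-variable inequality
`exists_integral_log_shift_le`.

Hence under the tilted law long stretches of length `M` have growth rate close to `f(h + cδ)`. Under
the true law such stretches occur with a probability `p` of order at least `exp(-M(δ² + ε))`
(`eventually_le_measureReal_goodBlocks`). Consider the renewal that visits only these stretches and
jumps over everything else. The gaps are of order `M/p`, and slow variation gives `log K(t) ≥ -C(1 +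
log t)`, so a jump costs about `C log(1/p)`, at most about `C M (δ² + ε)`. Since the free energy at
`h` is not positive, the gain of a stretch cannot exceed this cost (`rare_stretch_bound`). Dividing
by `M` bounds `f(h + cδ)` by a multiple of `δ²` (`growth_le_of_tilt`, `exists_smoothing`).

The argument applies at `h = h_c`: the free energy has increments at most those of the reward, so
being nonpositive below `h_c` it is nonpositive at `h_c` too (`exists_coe_eq_sInf`). -/

namespace Pinning

/-- The contribution of the configurations with `k` renewals to the partition function with
inter-arrival weights `K` and site potential `u`. -/
noncomputable def renewalSumAux (K : ℕ → ℝ) : ℕ → ℕ → (ℕ → ℝ) → ℝ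
  | 0, n, _ => if n = 0 then 1 else 0
  | k + 1, n, u => ∑ t ∈ Finset.Icc 1 n,
      K t * Real.exp (u t) * renewalSumAux K k (n - t) (fun a => u (a + t))

/-- The partition function with inter-arrival weights `K` and site potential `u`. -/
noncomputable def renewalSum (K : ℕ → ℝ) (n : ℕ) (u : ℕ → ℝ) : ℝ :=
  ∑ k ∈ Finset.range (n + 1), renewalSumAux K k n u

/-! ### Deterministic estimates on the partition function -/

section deterministic

variable {K : ℕ → ℝ}

lemma renewalSumAux_eq_zero {k n : ℕ} (h : n < k) (u : ℕ → ℝ) : renewalSumAux K k n u = 0 := by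
  induction k generalizing n u with
  | zero => omega
  | succ k ih =>
    refine Finset.sum_eq_zero fun t ht => ?_
    rw [Finset.mem_Icc] at ht
    rw [ih (by omega), mul_zero]

lemma renewalSum_eq_sum_range {m n : ℕ} (h : n < m) (u : ℕ → ℝ) :
    ∑ k ∈ Finset.range m, renewalSumAux K k n u = renewalSum K n u := by
  refine (Finset.sum_subset (Finset.range_subset_range.2 h) fun k _ hk => ?_).symm
  rw [Finset.mem_range] at hk
  exact renewalSumAux_eq_zero (by omega) u

@[simp] lemma renewalSum_zero (u : ℕ → ℝ) : renewalSum K 0 u = 1 := by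
  simp [renewalSum, renewalSumAux]

lemma renewalSum_eq {n : ℕ} (hn : 1 ≤ n) (u : ℕ → ℝ) :
    renewalSum K n u = ∑ t ∈ Finset.Icc 1 n,
      K t * Real.exp (u t) * renewalSum K (n - t) (fun a => u (a + t)) := by
  have h0 : n ≠ 0 := by omega
  rw [renewalSum, Finset.sum_range_succ']
  simp only [renewalSumAux, h0, if_false, add_zero]
  rw [Finset.sum_comm]
  refine Finset.sum_congr rfl fun t ht => ?_
  rw [Finset.mem_Icc] at ht
  rw [← Finset.mul_sum, renewalSum_eq_sum_range (by omega)]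

lemma continuous_renewalSumAux (k n : ℕ) : Continuous (renewalSumAux K k n) := by
  induction k generalizing n with
  | zero => exact continuous_const
  | succ k ih =>
    refine continuous_finsetSum _ fun t _ => ?_
    refine (continuous_const.mul (Real.continuous_exp.comp (continuous_apply t))).mul ?_
    exact (ih (n - t)).comp (continuous_pi fun a => continuous_apply (a + t))

lemma continuous_renewalSum (n : ℕ) : Continuous (renewalSum K n) :=
  continuous_finsetSum _ fun k _ => continuous_renewalSumAux k n

lemma renewalSum_congr {n : ℕ} {u v : ℕ → ℝ} (h : ∀ a ∈ Finset.Icc 1 n, u a = v a) :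
    renewalSum K n u = renewalSum K n v := by
  induction n using Nat.strong_induction_on generalizing u v with
  | _ n ih =>
    rcases Nat.eq_zero_or_pos n with rfl | hn
    · simp
    rw [renewalSum_eq hn, renewalSum_eq hn]
    refine Finset.sum_congr rfl fun t ht => ?_
    have ht' := Finset.mem_Icc.1 ht
    rw [h t ht, ih (n - t) (by omega)]
    intro a ha
    rw [Finset.mem_Icc] at ha
    exact h _ (Finset.mem_Icc.2 ⟨by omega, by omega⟩)

lemma renewalSum_nonneg (hK : ∀ t, 0 ≤ K t) (n : ℕ) (u : ℕ → ℝ) : 0 ≤ renewalSum K n u := by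
  induction n using Nat.strong_induction_on generalizing u with
  | _ n ih =>
    rcases Nat.eq_zero_or_pos n with rfl | hn
    · simp
    rw [renewalSum_eq hn]
    refine Finset.sum_nonneg fun t ht => ?_
    rw [Finset.mem_Icc] at ht
    exact mul_nonneg (mul_nonneg (hK t) (Real.exp_pos _).le) (ih (n - t) (by omega) _)

lemma single_jump_le_renewalSum (hK : ∀ t, 0 ≤ K t) {n : ℕ} (hn : 1 ≤ n) (u : ℕ → ℝ) :
    K n * Real.exp (u n) ≤ renewalSum K n u := by
  rw [renewalSum_eq hn]
  have := Finset.single_le_sum (s := Finset.Icc 1 n)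
    (f := fun t => K t * Real.exp (u t) * renewalSum K (n - t) (fun a => u (a + t)))
    (fun t _ => mul_nonneg (mul_nonneg (hK t) (Real.exp_pos _).le) (renewalSum_nonneg hK _ _))
    (Finset.mem_Icc.2 ⟨hn, le_rfl⟩)
  simpa using this

lemma renewalSum_pos (hK : ∀ t, 0 ≤ K t) (hK' : ∀ t, 1 ≤ t → 0 < K t) (n : ℕ) (u : ℕ → ℝ) :
    0 < renewalSum K n u := by
  rcases Nat.eq_zero_or_pos n with rfl | hn
  · simp
  · exact (mul_pos (hK' n hn) (Real.exp_pos _)).trans_le (single_jump_le_renewalSum hK hn u)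

/-- Concatenating a path to `n` with a path from `n` to `n + m` yields exactly the paths that renew
at `n`; the other paths have nonnegative weight. This is the source of superadditivity. -/
lemma renewalSum_mul_le (hK : ∀ t, 0 ≤ K t) (n m : ℕ) (u : ℕ → ℝ) :
    renewalSum K n u * renewalSum K m (fun a => u (a + n)) ≤ renewalSum K (n + m) u := by
  induction n using Nat.strong_induction_on generalizing u with
  | _ n ih =>
    rcases Nat.eq_zero_or_pos n with rfl | hn
    · simp
    rw [renewalSum_eq hn, renewalSum_eq (show 1 ≤ n + m by omega), Finset.sum_mul]
    refine (Finset.sum_le_sum fun t ht => ?_).trans (Finset.sum_le_sum_of_subset_of_nonneg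
      (Finset.Icc_subset_Icc le_rfl (Nat.le_add_right n m)) fun t _ _ =>
        mul_nonneg (mul_nonneg (hK t) (Real.exp_pos _).le) (renewalSum_nonneg hK _ _))
    rw [Finset.mem_Icc] at ht
    rw [mul_assoc]
    refine mul_le_mul_of_nonneg_left ?_ (mul_nonneg (hK t) (Real.exp_pos _).le)
    have := ih (n - t) (by omega) (fun a => u (a + t))
    rw [show n - t + m = n + m - t by omega] at this
    refine le_trans (le_of_eq ?_) this
    congr 2
    ext a
    congr 1
    omega

/-- Keep only the path that visits every site. -/
lemma pow_mul_exp_le_renewalSum (hK : ∀ t, 0 ≤ K t) (n : ℕ) (u : ℕ → ℝ) :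
    K 1 ^ n * Real.exp (∑ a ∈ Finset.Icc 1 n, u a) ≤ renewalSum K n u := by
  induction n with
  | zero => simp
  | succ n ih =>
    refine le_trans ?_ (renewalSum_mul_le hK n 1 u)
    have h1 := single_jump_le_renewalSum hK le_rfl (fun a => u (a + n))
    rw [Finset.sum_Icc_succ_top (by omega), Real.exp_add, pow_succ]
    calc _ = (K 1 ^ n * Real.exp (∑ a ∈ Finset.Icc 1 n, u a)) * (K 1 * Real.exp (u (1 + n))) := by
            rw [add_comm n 1]; ring
      _ ≤ _ := mul_le_mul ih h1 (mul_nonneg (hK 1) (Real.exp_pos _).le)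
            (renewalSum_nonneg hK _ _)

/-- Every jump has length at least one, so a path has at most `n` contacts, each gaining a factor
`exp s`. -/
lemma renewalSum_add_const_le (hK : ∀ t, 0 ≤ K t) (n : ℕ) (u : ℕ → ℝ) {s : ℝ} (hs : 0 ≤ s) :
    renewalSum K n (fun a => s + u a) ≤ Real.exp (n * s) * renewalSum K n u := by
  induction n using Nat.strong_induction_on generalizing u with
  | _ n ih =>
    rcases Nat.eq_zero_or_pos n with rfl | hn
    · simp
    rw [renewalSum_eq hn, renewalSum_eq hn, Finset.mul_sum]
    refine Finset.sum_le_sum fun t ht => ?_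
    rw [Finset.mem_Icc] at ht
    calc _ ≤ K t * Real.exp (s + u t) * (Real.exp ((n - t : ℕ) * s) *
            renewalSum K (n - t) (fun a => u (a + t))) :=
          mul_le_mul_of_nonneg_left (ih (n - t) (by omega) fun a => u (a + t))
            (mul_nonneg (hK t) (Real.exp_pos _).le)
      _ = Real.exp (s + (n - t : ℕ) * s) * (K t * Real.exp (u t) *
            renewalSum K (n - t) (fun a => u (a + t))) := by
          rw [Real.exp_add, Real.exp_add]; ring
      _ ≤ _ := by
          refine mul_le_mul_of_nonneg_right (Real.exp_le_exp.2 ?_)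
            (mul_nonneg (mul_nonneg (hK t) (Real.exp_pos _).le) (renewalSum_nonneg hK _ _))
          rw [Nat.cast_sub ht.2]
          have : (1 : ℝ) ≤ t := by exact_mod_cast ht.1
          nlinarith

lemma renewalSum_le_exp (hK : ∀ t, 0 ≤ K t) (hK1 : ∀ n, ∑ t ∈ Finset.Icc 1 n, K t ≤ 1) (n : ℕ)
    (u : ℕ → ℝ) : renewalSum K n u ≤ Real.exp (∑ a ∈ Finset.Icc 1 n, |u a|) := by
  induction n using Nat.strong_induction_on generalizing u with
  | _ n ih =>
    rcases Nat.eq_zero_or_pos n with rfl | hn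
    · simp
    rw [renewalSum_eq hn]
    calc _ ≤ ∑ t ∈ Finset.Icc 1 n, K t * Real.exp (∑ a ∈ Finset.Icc 1 n, |u a|) := by
          refine Finset.sum_le_sum fun t ht => ?_
          rw [Finset.mem_Icc] at ht
          rw [mul_assoc]
          refine mul_le_mul_of_nonneg_left ?_ (hK t)
          refine (mul_le_mul_of_nonneg_left (ih (n - t) (by omega) fun a => u (a + t))
            (Real.exp_pos _).le).trans ?_
          rw [← Real.exp_add]
          refine Real.exp_le_exp.2 ?_
          have e : ∑ a ∈ Finset.Icc 1 (n - t), |u (a + t)| = ∑ a ∈ Finset.Icc (t + 1) n, |u a| := by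
            refine Finset.sum_bij (fun a _ => a + t) ?_ ?_ ?_ ?_
            · intro a ha; rw [Finset.mem_Icc] at ha ⊢; omega
            · intro a _ b _ h; omega
            · intro b hb
              rw [Finset.mem_Icc] at hb
              exact ⟨b - t, Finset.mem_Icc.2 (by omega), by omega⟩
            · intro a _; rfl
          rw [e]
          calc _ ≤ |u t| + ∑ a ∈ Finset.Icc (t + 1) n, |u a| := by gcongr; exact le_abs_self _
            _ = ∑ a ∈ insert t (Finset.Icc (t + 1) n), |u a| := by
                rw [Finset.sum_insert (by simp)]
            _ ≤ _ := Finset.sum_le_sum_of_subset_of_nonneg (by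
                intro a ha
                simp only [Finset.mem_insert, Finset.mem_Icc] at ha ⊢
                omega) fun _ _ _ => abs_nonneg _
      _ = (∑ t ∈ Finset.Icc 1 n, K t) * Real.exp (∑ a ∈ Finset.Icc 1 n, |u a|) := by
          rw [Finset.sum_mul]
      _ ≤ 1 * _ := mul_le_mul_of_nonneg_right (hK1 n) (Real.exp_pos _).le
      _ = _ := one_mul _

/-- The partition function is affine in the Boltzmann weight of every site. -/
lemma exists_renewalSum_update_eq (hK : ∀ t, 0 ≤ K t) (n : ℕ) (u : ℕ → ℝ) (i : ℕ) :
    ∃ A B : ℝ, 0 ≤ A ∧ 0 ≤ B ∧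
      ∀ s, renewalSum K n (Function.update u i s) = A + B * Real.exp s := by
  induction n using Nat.strong_induction_on generalizing u i with
  | _ n ih =>
    rcases Nat.eq_zero_or_pos n with rfl | hn
    · exact ⟨1, 0, zero_le_one, le_rfl, fun s => by simp⟩
    have key : ∀ t ∈ Finset.Icc 1 n, ∃ A B : ℝ, 0 ≤ A ∧ 0 ≤ B ∧ ∀ s,
        K t * Real.exp (Function.update u i s t) *
          renewalSum K (n - t) (fun a => Function.update u i s (a + t)) = A + B * Real.exp s := by
      intro t ht
      rw [Finset.mem_Icc] at ht
      -- If the first jump lands before `i`, the site survives in the shifted problem; if it lands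
      -- on `i`, the weight is proportional to `exp s`; if it lands beyond, the site is skipped and
      -- `s` does not enter.
      rcases lt_trichotomy t i with h | rfl | h
      · obtain ⟨A, B, hA, hB, e⟩ := ih (n - t) (by omega) (fun a => u (a + t)) (i - t)
        refine ⟨K t * Real.exp (u t) * A, K t * Real.exp (u t) * B,
          mul_nonneg (mul_nonneg (hK t) (Real.exp_pos _).le) hA,
          mul_nonneg (mul_nonneg (hK t) (Real.exp_pos _).le) hB, fun s => ?_⟩
        have e2 : (fun a => Function.update u i s (a + t)) =
            Function.update (fun a => u (a + t)) (i - t) s := by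
          ext a
          by_cases ha : a = i - t
          · subst ha
            simp [Nat.sub_add_cancel h.le]
          · rw [Function.update_of_ne ha, Function.update_of_ne (by omega)]
        rw [e2, e, Function.update_of_ne h.ne]
        ring
      · refine ⟨0, K t * renewalSum K (n - t) (fun a => u (a + t)), le_rfl,
          mul_nonneg (hK t) (renewalSum_nonneg hK _ _), fun s => ?_⟩
        rw [Function.update_self, renewalSum_congr (v := fun a => u (a + t))]
        · ring
        · intro a ha
          rw [Finset.mem_Icc] at ha
          rw [Function.update_of_ne (by omega)]
      · refine ⟨K t * Real.exp (u t) * renewalSum K (n - t) (fun a => u (a + t)), 0,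
          mul_nonneg (mul_nonneg (hK t) (Real.exp_pos _).le) (renewalSum_nonneg hK _ _), le_rfl,
          fun s => ?_⟩
        rw [Function.update_of_ne h.ne', renewalSum_congr (v := fun a => u (a + t))]
        · ring
        · intro a ha
          rw [Function.update_of_ne (by omega)]
    choose! A B hA hB e using key
    refine ⟨∑ t ∈ Finset.Icc 1 n, A t, ∑ t ∈ Finset.Icc 1 n, B t, Finset.sum_nonneg hA,
      Finset.sum_nonneg hB, fun s => ?_⟩
    rw [renewalSum_eq hn, Finset.sum_mul, ← Finset.sum_add_distrib]
    exact Finset.sum_congr rfl fun t ht => e t ht s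

lemma abs_log_renewalSum_le (hK : ∀ t, 0 ≤ K t) (hK' : ∀ t, 1 ≤ t → 0 < K t)
    (hK1 : ∀ n, ∑ t ∈ Finset.Icc 1 n, K t ≤ 1) (n : ℕ) (u : ℕ → ℝ) :
    |Real.log (renewalSum K n u)| ≤ n * |Real.log (K 1)| + ∑ a ∈ Finset.Icc 1 n, |u a| := by
  have hpos := renewalSum_pos hK hK' n u
  rw [abs_le]
  constructor
  · have h1 := Real.log_le_log (mul_pos (pow_pos (hK' 1 le_rfl) n) (Real.exp_pos _))
      (pow_mul_exp_le_renewalSum hK n u)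
    rw [Real.log_mul (pow_pos (hK' 1 le_rfl) n).ne' (Real.exp_pos _).ne', Real.log_pow,
      Real.log_exp] at h1
    have h2 : -∑ a ∈ Finset.Icc 1 n, |u a| ≤ ∑ a ∈ Finset.Icc 1 n, u a := by
      rw [← Finset.sum_neg_distrib]
      exact Finset.sum_le_sum fun a _ => neg_abs_le _
    have h3 : -(n * |Real.log (K 1)|) ≤ n * Real.log (K 1) := by
      rw [← mul_neg]
      exact mul_le_mul_of_nonneg_left (neg_abs_le _) n.cast_nonneg
    linarith
  · have h1 := Real.log_le_log hpos (renewalSum_le_exp hK hK1 n u)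
    rw [Real.log_exp] at h1
    have : 0 ≤ n * |Real.log (K 1)| := by positivity
    linarith

end deterministic

/-! ### Independence of functions of disjoint sets of coordinates -/

section independence

lemma comap_le_of_dependsOn {ι Ω E β : Type*} [MeasurableSpace E] [Inhabited E]
    [MeasurableSpace β] (X : ι → Ω → E) {F : (ι → E) → β} {s : Set ι} (hF : Measurable F)
    (hFs : DependsOn F s) : MeasurableSpace.comap (fun x => F fun i => X i x) inferInstance ≤
      ⨆ i ∈ s, MeasurableSpace.comap (X i) inferInstance := by
  classical
  rw [← measurable_iff_comap_le]
  -- Freezing the coordinates outside `s` at a default value leaves `F` unchanged and makes its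
  -- argument measurable for the σ-algebra generated by the `X i`, `i ∈ s`.
  have e : (fun x => F fun i => X i x) = fun x => F fun i => if i ∈ s then X i x else default := by
    ext1 x
    exact hFs fun i hi => by simp [hi]
  rw [e]
  refine hF.comp (@measurable_pi_lambda _ _ _ (_) _ _ fun i => ?_)
  by_cases hi : i ∈ s
  · simp only [hi, if_true]
    exact measurable_iff_comap_le.2 (le_iSup₂_of_le i hi le_rfl)
  · simp only [hi, if_false]
    exact measurable_const

/-- Functions of disjoint groups of independent random variables are independent. -/
lemma indepFun_of_dependsOn {ι Ω E β γ : Type*} [MeasurableSpace Ω] [MeasurableSpace E]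
    [Inhabited E] [MeasurableSpace β] [MeasurableSpace γ] {μ : Measure Ω} {X : ι → Ω → E}
    (h : iIndepFun X μ) (hX : ∀ i, Measurable (X i)) {s t : Set ι} (hst : Disjoint s t)
    {F : (ι → E) → β} {G : (ι → E) → γ} (hF : Measurable F) (hG : Measurable G)
    (hFs : DependsOn F s) (hGt : DependsOn G t) :
    IndepFun (fun x => F fun i => X i x) (fun x => G fun i => X i x) μ := by
  rw [IndepFun_iff_Indep]
  exact indep_of_indep_of_le_left (indep_of_indep_of_le_right
    (indep_iSup_of_disjoint (fun i => (hX i).comap_le) h hst) (comap_le_of_dependsOn X hG hGt))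
    (comap_le_of_dependsOn X hF hFs)

end independence

/-! ### The probabilistic partition function as a renewal sum -/

section representation

variable {S : Type*} {T : ℕ → S → ℕ}

/-- The Boltzmann weight of the first `k` renewals, on the event that the `k`-th one is `n`. -/
noncomputable def boltzmannWeight (k n : ℕ) (u : ℕ → ℝ) (τ : ℕ → ℕ) : ℝ :=
  if ∑ i ∈ Finset.range k, τ i = n then
    Real.exp (∑ i ∈ Finset.Icc 1 k, u (∑ l ∈ Finset.range i, τ l)) else 0

lemma measurable_boltzmannWeight (k n : ℕ) (u : ℕ → ℝ) : Measurable (boltzmannWeight k n u) := by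
  have h : ∀ i, Measurable fun τ : ℕ → ℕ => ∑ l ∈ Finset.range i, τ l := fun i =>
    Finset.measurable_fun_sum _ fun l _ => measurable_pi_apply l
  refine Measurable.ite (measurableSet_eq_fun (h k) measurable_const) ?_ measurable_const
  refine Real.measurable_exp.comp (Finset.measurable_fun_sum _ fun i _ => ?_)
  exact (measurable_of_countable u).comp (h i)

lemma abs_boltzmannWeight_le (k n : ℕ) (u : ℕ → ℝ) (τ : ℕ → ℕ) :
    |boltzmannWeight k n u τ| ≤ Real.exp (k * ∑ a ∈ Finset.range (n + 1), |u a|) := by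
  rw [boltzmannWeight]
  split_ifs with h
  · rw [Real.abs_exp]
    refine Real.exp_le_exp.2 ?_
    calc _ ≤ ∑ i ∈ Finset.Icc 1 k, ∑ a ∈ Finset.range (n + 1), |u a| := by
          refine Finset.sum_le_sum fun i hi => (le_abs_self _).trans ?_
          refine Finset.single_le_sum (f := fun a => |u a|) (fun a _ => abs_nonneg _) ?_
          rw [Finset.mem_range, ← h, Nat.lt_succ_iff]
          refine Finset.sum_le_sum_of_subset (Finset.range_subset_range.2 (Finset.mem_Icc.1 hi).2)
      _ = _ := by simp
  · rw [abs_zero]; exact (Real.exp_pos _).le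

/-- Decomposition at the first jump: only the summand `t = τ 0` survives. It mirrors the recursion
defining `renewalSumAux`. -/
lemma boltzmannWeight_succ (k n : ℕ) (u : ℕ → ℝ) {τ : ℕ → ℕ} (hτ : ∀ i, 1 ≤ τ i) :
    boltzmannWeight (k + 1) n u τ = ∑ t ∈ Finset.Icc 1 n, (if τ 0 = t then Real.exp (u t) else 0) *
      boltzmannWeight k (n - t) (fun a => u (a + t)) (fun i => τ (i + 1)) := by
  by_cases h0 : τ 0 ≤ n
  · rw [Finset.sum_eq_single_of_mem (τ 0) (Finset.mem_Icc.2 ⟨hτ 0, h0⟩)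
      fun t _ ht => by rw [if_neg ht.symm, zero_mul]]
    rw [if_pos rfl, boltzmannWeight, boltzmannWeight, Finset.sum_range_succ']
    by_cases h1 : ∑ i ∈ Finset.range k, τ (i + 1) = n - τ 0
    · rw [if_pos (by omega), if_pos h1, ← Real.exp_add]
      congr 1
      have e : Finset.Icc 1 (k + 1) = insert 1 (Finset.Icc 2 (k + 1)) := by
        ext a; simp only [Finset.mem_insert, Finset.mem_Icc]; omega
      rw [e, Finset.sum_insert (by simp)]
      refine congrArg₂ _ (by simp) (Finset.sum_bij (fun a _ => a + 1) ?_ ?_ ?_ ?_).symm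
      · intro a ha; rw [Finset.mem_Icc] at ha ⊢; omega
      · intro a _ b _ h; omega
      · intro b hb
        rw [Finset.mem_Icc] at hb
        exact ⟨b - 1, Finset.mem_Icc.2 (by omega), by omega⟩
      · intro a _
        rw [Finset.sum_range_succ']
    · rw [if_neg (by omega), if_neg h1, mul_zero]
  · rw [Finset.sum_eq_zero, boltzmannWeight, if_neg]
    · rw [Finset.sum_range_succ']
      omega
    · intro t ht
      rw [Finset.mem_Icc] at ht
      rw [if_neg (by omega), zero_mul]

lemma renewalTime_lt (hTpos : ∀ i s, 1 ≤ T i s) (s : S) : StrictMono fun i => renewalTime T i s :=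
  strictMono_nat_of_lt_succ fun i => by
    simp only [renewalTime, Finset.sum_range_succ]
    have := hTpos i s
    omega

lemma contactNumber_eq (hTpos : ∀ i s, 1 ≤ T i s) {s : S} {k n : ℕ} (h : renewalTime T k s = n) :
    contactNumber T n s = k := by
  have : {i : ℕ | renewalTime T i s ≤ n} = Set.Iic k := by
    ext i
    rw [Set.mem_ofPred_eq, ← h]
    exact (renewalTime_lt hTpos s).le_iff_le
  rw [contactNumber, this, csSup_Iic]

/-- Renewal times increase strictly, so at most one `k` has `S_k = n`; it satisfies `k ≤ n` and
equals `L_n`. -/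
lemma indicator_renewalEvent (hTpos : ∀ i s, 1 ≤ T i s) (n : ℕ) (h : ℝ) (w : ℕ → ℝ) (s : S) :
    (renewalEvent T n).indicator (fun s => Real.exp (∑ i ∈ Finset.Icc 1 (contactNumber T n s),
      (h + w (renewalTime T i s)))) s =
    ∑ k ∈ Finset.range (n + 1), boltzmannWeight k n (fun a => h + w a) (fun i => T (0 + i) s) := by
  simp only [zero_add]
  by_cases hs : s ∈ renewalEvent T n
  · rw [Set.indicator_of_mem hs]
    obtain ⟨k, hk⟩ := hs
    have hkn : k ≤ n := hk ▸ (renewalTime_lt hTpos s).le_apply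
    rw [Finset.sum_eq_single_of_mem k (Finset.mem_range.2 (by omega))]
    · rw [contactNumber_eq hTpos hk, boltzmannWeight]
      exact (if_pos hk).symm
    · intro b _ hb
      refine if_neg fun h' => ?_
      exact hb ((renewalTime_lt hTpos s).injective (h'.trans hk.symm))
  · rw [Set.indicator_of_notMem hs, Finset.sum_eq_zero]
    intro k _
    exact if_neg fun h' => hs ⟨k, h'⟩

variable [MeasurableSpace S] {P : Measure S} [IsProbabilityMeasure P]

/-- The first jump is independent of the later ones. The offset `j` makes the induction close, since
removing a jump leaves the sequence that starts at `j + 1`. -/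
lemma integral_boltzmannWeight (hT : ∀ i, Measurable (T i)) (hTpos : ∀ i s, 1 ≤ T i s)
    (hind : iIndepFun T P) (hid : ∀ i, IdentDistrib (T i) (T 0) P P) (k n : ℕ) (u : ℕ → ℝ)
    (j : ℕ) : ∫ s, boltzmannWeight k n u (fun i => T (j + i) s) ∂P =
      renewalSumAux (fun t => P.real {s | T 0 s = t}) k n u := by
  induction k generalizing n u j with
  | zero =>
    simp [boltzmannWeight, renewalSumAux, eq_comm]
  | succ k ih =>
    have hm : ∀ j : ℕ, Measurable fun s i => T (j + i) s := fun j =>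
      measurable_pi_lambda _ fun i => hT _
    have hm1 : ∀ t : ℕ, Measurable fun m : ℕ => if m = t then Real.exp (u t) else 0 := fun t =>
      measurable_of_countable _
    have hint : ∀ (j k n : ℕ) (u : ℕ → ℝ),
        Integrable (fun s => boltzmannWeight k n u (fun i => T (j + i) s)) P := fun j k n u =>
      Integrable.of_bound ((measurable_boltzmannWeight k n u).comp (hm j)).aestronglyMeasurable _
        (ae_of_all _ fun s => abs_boltzmannWeight_le k n u _)
    have e : ∀ s, boltzmannWeight (k + 1) n u (fun i => T (j + i) s) =
        ∑ t ∈ Finset.Icc 1 n, (if T j s = t then Real.exp (u t) else 0) *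
          boltzmannWeight k (n - t) (fun a => u (a + t)) (fun i => T (j + 1 + i) s) := by
      intro s
      rw [boltzmannWeight_succ k n u fun i => hTpos _ _]
      simp only [add_zero, add_right_comm j 1, add_assoc]
    simp_rw [e]
    rw [integral_finsetSum]
    · refine Finset.sum_congr rfl fun t _ => ?_
      have hI : IndepFun (fun s => if T j s = t then Real.exp (u t) else 0)
          (fun s => boltzmannWeight k (n - t) (fun a => u (a + t)) (fun i => T (j + 1 + i) s)) P := by
        refine indepFun_of_dependsOn (s := {j}) (t := Set.Ioi j)
          (F := fun τ => if τ j = t then Real.exp (u t) else 0)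
          (G := fun τ => boltzmannWeight k (n - t) (fun a => u (a + t)) (fun i => τ (j + 1 + i)))
          hind hT (by simp) ((hm1 t).comp (measurable_pi_apply j))
          ((measurable_boltzmannWeight _ _ _).comp
            (measurable_pi_lambda _ fun i => measurable_pi_apply _)) ?_ ?_
        · intro x y hxy
          simp only [hxy j rfl]
        · intro x y hxy
          have : (fun i => x (j + 1 + i)) = fun i => y (j + 1 + i) :=
            funext fun i => hxy _ (by simp only [Set.mem_Ioi]; omega)
          simp only [this]
      rw [hI.integral_fun_mul_eq_mul_integral
        (((hm1 t).comp (hT j)).aestronglyMeasurable)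
        (((measurable_boltzmannWeight _ _ _).comp (hm (j + 1))).aestronglyMeasurable), ih]
      congr 1
      have e2 : (fun s => if T j s = t then Real.exp (u t) else 0) =
          (T j ⁻¹' {t}).indicator fun _ => Real.exp (u t) := by
        ext s
        simp [Set.indicator]
      rw [e2, integral_indicator_const _ (hT j (measurableSet_singleton t)), smul_eq_mul]
      congr 1
      simp only [Measure.real]
      rw [(hid j).measure_preimage_eq (measurableSet_singleton t)]
      rfl
    · intro t _
      refine (hint (j + 1) k (n - t) fun a => u (a + t)).bdd_mul
        ((hm1 t).comp (hT j)).aestronglyMeasurable (c := Real.exp (u t)) (ae_of_all _ fun s => ?_)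
      split_ifs
      · rw [Real.norm_eq_abs, Real.abs_exp]
      · rw [norm_zero]; exact (Real.exp_pos _).le

/-- The partition function is an explicit function of the law of the inter-arrival times. -/
theorem partitionFunction_eq (hT : ∀ i, Measurable (T i)) (hTpos : ∀ i s, 1 ≤ T i s)
    (hind : iIndepFun T P) (hid : ∀ i, IdentDistrib (T i) (T 0) P P) (n : ℕ) (h : ℝ) (w : ℕ → ℝ) :
    partitionFunction P T n h w =
      renewalSum (fun t => P.real {s | T 0 s = t}) n (fun a => h + w a) := by
  simp only [partitionFunction, indicator_renewalEvent hTpos]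
  rw [integral_finsetSum]
  · exact Finset.sum_congr rfl fun k _ => integral_boltzmannWeight hT hTpos hind hid k n _ 0
  · intro k _
    exact Integrable.of_bound ((measurable_boltzmannWeight _ _ _).comp
      (measurable_pi_lambda _ fun i => hT _)).aestronglyMeasurable _
        (ae_of_all _ fun s => abs_boltzmannWeight_le _ _ _ _)

lemma sum_measureReal_le_one (hT : Measurable (T 0)) (n : ℕ) :
    ∑ t ∈ Finset.Icc 1 n, P.real {s | T 0 s = t} ≤ 1 := by
  rw [← measureReal_biUnion_finset]
  · exact measureReal_le_one
  · intro a _ b _ hab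
    exact Set.disjoint_left.2 fun s hs hs' => hab (hs.symm.trans hs')
  · intro t _
    exact hT (measurableSet_singleton t)

end representation

/-! ### Slow variation and polynomial lower bounds on the weights -/

section slowVariation

/-- Local boundedness of the increments of a measurable function which is slowly varying in the
additive sense. -/
lemma exists_forall_abs_sub_le_one {H : ℝ → ℝ} (hH : Measurable H)
    (hlim : ∀ u, Tendsto (fun x => H (x + u) - H x) atTop (𝓝 0)) :
    ∃ X, ∀ x, X ≤ x → ∀ u ∈ Set.Icc (0 : ℝ) 1, |H (x + u) - H x| ≤ 1 := by
  by_contra! hcon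
  choose x hx u hu hux using fun n : ℕ => hcon n
  -- Pointwise convergence of the increments gives convergence in measure on `[0, 3]`. It is used
  -- along `x n` and along `x n + u n`.
  have key : ∀ z : ℕ → ℝ, (∀ n : ℕ, (n : ℝ) ≤ z n) → Tendsto (fun n => (volume.restrict
      (Set.Icc (0 : ℝ) 3)) {y | (1 / 2 : ℝ) ≤ |H (z n + y) - H (z n)|}) atTop (𝓝 0) := by
    intro z hz
    have hz' : Tendsto z atTop atTop := tendsto_atTop_mono hz tendsto_natCast_atTop_atTop
    have h := tendstoInMeasure_of_tendsto_ae (μ := volume.restrict (Set.Icc (0 : ℝ) 3))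
      (f := fun n y => H (z n + y) - H (z n)) (g := fun _ => 0)
      (fun n => ((hH.comp (measurable_const_add _)).sub_const _).aestronglyMeasurable)
      (ae_of_all _ fun y => (hlim y).comp hz')
    rw [tendstoInMeasure_iff_dist] at h
    simpa [Real.dist_eq] using h (1 / 2) (by norm_num)
  have hA := (key x hx).eventually_lt_const (u := 1 / 2) (by simp)
  have hB := (key (fun n => x n + u n) fun n => (hx n).trans
    (le_add_of_nonneg_right (hu n).1)).eventually_lt_const (u := 1 / 2) (by simp)
  obtain ⟨n, hAn, hBn⟩ := (hA.and hB).exists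
  set A := {y | (1 / 2 : ℝ) ≤ |H (x n + y) - H (x n)|}
  set B := {y | (1 / 2 : ℝ) ≤ |H (x n + u n + y) - H (x n + u n)|}
  -- A point `y` outside both bad sets would make `H (x n + y)` within `1/2` of both `H (x n)` and
  -- `H (x n + u n)`, contradicting the choice of `u n`. So two sets of measure below `1/2` cover an
  -- interval of length one.
  have hsub : Set.Icc (1 : ℝ) 2 ⊆
      (A ∩ Set.Icc 0 3) ∪ (fun y => y - u n) ⁻¹' (B ∩ Set.Icc 0 3) := by
    intro y hy
    by_contra hny
    simp only [Set.mem_union, Set.mem_inter_iff, Set.mem_preimage, not_or, Set.mem_Icc] at hny hy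
    have h1 : y ∉ A := fun h => hny.1 ⟨h, by linarith, by linarith⟩
    have h2 : y - u n ∉ B := fun h => hny.2
      ⟨h, by linarith [(hu n).2], by linarith [(hu n).1]⟩
    simp only [A, B, Set.mem_ofPred_eq, not_le] at h1 h2
    rw [show x n + u n + (y - u n) = x n + y by ring] at h2
    have := hux n
    rw [abs_lt] at h1 h2
    rw [lt_abs] at this
    rcases this with h | h <;> linarith
  have h1 := (measure_mono (μ := volume) hsub).trans (measure_union_le _ _)
  have h0 : volume ((fun y => y - u n) ⁻¹' (B ∩ Set.Icc 0 3)) = volume (B ∩ Set.Icc 0 3) := by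
    simpa only [sub_eq_add_neg] using measure_preimage_add_right volume (-u n) (B ∩ Set.Icc 0 3)
  rw [h0, ← Measure.restrict_apply' measurableSet_Icc,
    ← Measure.restrict_apply' measurableSet_Icc] at h1
  have h2 := h1.trans_lt (ENNReal.add_lt_add hAn hBn)
  rw [Real.volume_Icc, ENNReal.add_halves] at h2
  norm_num at h2

/-- Unit steps decrease `H` by at most one, and the fractional remainder costs at most one more. The
slope `-1` is crude, but any linear bound gives a polynomial bound on `ℓ`. -/
lemma exists_linear_lower_bound {H : ℝ → ℝ} (hH : Measurable H)
    (hlim : ∀ u, Tendsto (fun x => H (x + u) - H x) atTop (𝓝 0)) :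
    ∃ b, ∀ᶠ x in atTop, b - x ≤ H x := by
  obtain ⟨X, hX⟩ := exists_forall_abs_sub_le_one hH hlim
  refine ⟨H X + X - 1, (eventually_ge_atTop X).mono fun x hx => ?_⟩
  have hm : ∀ m : ℕ, H X - m ≤ H (X + m) := by
    intro m
    induction m with
    | zero => simp
    | succ m ih =>
      have := (abs_le.1 (hX (X + m) (by simp) 1 (by simp))).1
      push_cast
      rw [← add_assoc]
      linarith
  have h1 := hm ⌊x - X⌋₊
  have h2 := Nat.floor_le (sub_nonneg.2 hx)
  have h3 := Nat.lt_floor_add_one (x - X)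
  have h4 := (abs_le.1 (hX (X + ⌊x - X⌋₊) (by simp) (x - X - ⌊x - X⌋₊)
    ⟨by linarith, by linarith⟩)).1
  rw [show X + (⌊x - X⌋₊ : ℝ) + (x - X - ⌊x - X⌋₊) = x by ring] at h4
  linarith

lemma exists_pos_forall_le {a : ℕ → ℝ} (ha : ∀ t, 1 ≤ t → 0 < a t) {c : ℝ} (hc : 0 < c)
    (h : ∀ᶠ t in atTop, c ≤ a t) : ∃ c', 0 < c' ∧ ∀ t, 1 ≤ t → c' ≤ a t := by
  obtain ⟨N, hN⟩ := eventually_atTop.1 h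
  have key : ∀ n : ℕ, ∃ c', 0 < c' ∧ ∀ t, 1 ≤ t → t < n → c' ≤ a t := by
    intro n
    induction n with
    | zero => exact ⟨1, one_pos, fun t _ ht => absurd ht (by omega)⟩
    | succ n ih =>
      obtain ⟨c', hc', h'⟩ := ih
      rcases Nat.eq_zero_or_pos n with rfl | hn
      · exact ⟨1, one_pos, fun t ht ht' => absurd ht' (by omega)⟩
      refine ⟨min c' (a n), lt_min hc' (ha n hn), fun t ht htn => ?_⟩
      rcases Nat.lt_succ_iff_lt_or_eq.1 htn with h1 | rfl
      · exact (min_le_left _ _).trans (h' t ht h1)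
      · exact min_le_right _ _
  obtain ⟨c', hc', h'⟩ := key N
  refine ⟨min c' c, lt_min hc' hc, fun t ht => ?_⟩
  rcases lt_or_ge t N with h1 | h1
  · exact (min_le_left _ _).trans (h' t ht h1)
  · exact (min_le_right _ _).trans (hN t h1)

/-- A slowly varying function which is positive on the positive integers is bounded from below by
a multiple of the inverse on the positive integers. -/
lemma SlowlyVarying.exists_div_le {ℓ : ℝ → ℝ} (hℓ : SlowlyVarying ℓ)
    (hpos : ∀ t : ℕ, 1 ≤ t → 0 < ℓ t) : ∃ c, 0 < c ∧ ∀ t : ℕ, 1 ≤ t → c / t ≤ ℓ t := by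
  obtain ⟨hm, hev, hlim⟩ := hℓ
  -- The truncation `max x 0` keeps the argument of `ℓ` in `[1, ∞)`, where measurability is known.
  set H : ℝ → ℝ := fun x => Real.log (ℓ (Real.exp (max x 0)))
  have hH : Measurable H := by
    have h1 : Measurable fun x : ℝ => (⟨Real.exp (max x 0),
        Real.one_le_exp (le_max_right _ _)⟩ : Set.Ici (1 : ℝ)) :=
      Measurable.subtype_mk (Real.measurable_exp.comp (measurable_id.max measurable_const))
    exact Real.measurable_log.comp (hm.comp h1)
  have hHlim : ∀ u, Tendsto (fun x => H (x + u) - H x) atTop (𝓝 0) := by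
    intro u
    have h1 := (hlim (Real.exp u) (Real.exp_pos u)).comp Real.tendsto_exp_atTop
    have h2 := (Real.continuousAt_log one_ne_zero).tendsto.comp h1
    rw [Real.log_one] at h2
    refine h2.congr' ?_
    have h3 := Real.tendsto_exp_atTop.eventually hev
    have h4 := (Real.tendsto_exp_atTop.comp (tendsto_atTop_add_const_right _ u
      tendsto_id)).eventually hev
    filter_upwards [h3, h4, eventually_ge_atTop 0, eventually_ge_atTop (-u)] with x h3 h4 h5 h6
    simp only [Function.comp_apply, id] at h4 ⊢
    simp only [H]
    rw [max_eq_left h5, max_eq_left (by linarith), ← Real.exp_add, add_comm u x,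
      Real.log_div h4.ne' h3.ne']
  obtain ⟨b, hb⟩ := exists_linear_lower_bound hH hHlim
  have h1 : ∀ᶠ t : ℕ in atTop, Real.exp b ≤ ℓ t * t := by
    have h2 := (Real.tendsto_log_atTop.comp tendsto_natCast_atTop_atTop).eventually hb
    filter_upwards [h2, eventually_ge_atTop 1] with t h2 ht
    have ht1 : (1 : ℝ) ≤ t := by exact_mod_cast ht
    have ht0 : (0 : ℝ) < t := by linarith
    simp only [Function.comp_apply, H] at h2
    rw [max_eq_left (Real.log_nonneg ht1), Real.exp_log ht0] at h2
    rw [← Real.le_log_iff_exp_le (mul_pos (hpos t ht) ht0), Real.log_mul (hpos t ht).ne' ht0.ne']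
    linarith
  obtain ⟨c, hc, h2⟩ := exists_pos_forall_le (fun t ht => mul_pos (hpos t ht) (by
    exact_mod_cast ht)) (Real.exp_pos b) h1
  refine ⟨c, hc, fun t ht => ?_⟩
  rw [div_le_iff₀ (by exact_mod_cast ht)]
  exact h2 t ht

/-- Polynomial lower bound on regularly varying weights. -/
lemma SlowlyVarying.exists_le_log {ℓ : ℝ → ℝ} (hℓ : SlowlyVarying ℓ) {α : ℝ} {K : ℕ → ℝ}
    (hK : ∀ t : ℕ, 1 ≤ t → K t = ℓ t / (t : ℝ) ^ (α + 1) ∧ 0 < K t) :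
    ∃ C, 0 ≤ C ∧ ∀ t : ℕ, 1 ≤ t → -(C * (1 + Real.log t)) ≤ Real.log (K t) := by
  have hp : ∀ t : ℕ, 1 ≤ t → 0 < (t : ℝ) ^ (α + 1) := fun t ht =>
    Real.rpow_pos_of_pos (by exact_mod_cast ht) _
  have hpos : ∀ t : ℕ, 1 ≤ t → 0 < ℓ t := by
    intro t ht
    have h := (hK t ht).2
    rw [(hK t ht).1] at h
    exact (div_pos_iff_of_pos_right (hp t ht)).1 h
  obtain ⟨c, hc, h⟩ := hℓ.exists_div_le hpos
  -- The exponent `α + 2` combines `α + 1` from the weight with `1` from the bound `c / t ≤ ℓ t`.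
  refine ⟨|Real.log c| + |α + 2|, by positivity, fun t ht => ?_⟩
  have ht0 : (0 : ℝ) < t := by exact_mod_cast ht
  have hlog : 0 ≤ Real.log t := Real.log_nonneg (by exact_mod_cast ht)
  rw [(hK t ht).1, Real.log_div (hpos t ht).ne' (hp t ht).ne', Real.log_rpow ht0]
  have h1 := Real.log_le_log (div_pos hc ht0) (h t ht)
  rw [Real.log_div hc.ne' ht0.ne'] at h1
  have h2 := neg_abs_le (Real.log c)
  have h3 := mul_le_mul_of_nonneg_right (le_abs_self (α + 2)) hlog
  have h4 := mul_nonneg (abs_nonneg (Real.log c)) hlog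
  have h5 := abs_nonneg (α + 2)
  nlinarith

end slowVariation

/-! ### Product measures: resampling, comparison and densities -/

section productMeasure

open Measure

variable {P P' : ℕ → Measure ℝ} [∀ i, IsProbabilityMeasure (P i)]
  [∀ i, IsProbabilityMeasure (P' i)]

lemma measurable_update_prod (i : ℕ) :
    Measurable fun p : ℝ × (ℕ → ℝ) => Function.update p.2 i p.1 := by
  refine measurable_pi_lambda _ fun j => ?_
  by_cases h : j = i
  · subst h
    simpa using measurable_fst
  · simp only [Function.update_of_ne h]
    exact (measurable_pi_apply j).comp measurable_snd

/-- Resampling one coordinate of a product measure. -/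
lemma map_update_prod_infinitePi (i : ℕ) (h : ∀ j, j ≠ i → P' j = P j) :
    ((P' i).prod (infinitePi P)).map (fun p => Function.update p.2 i p.1) = infinitePi P' := by
  refine eq_infinitePi _ fun s t ht => ?_
  rw [Measure.map_apply (measurable_update_prod i)
    (MeasurableSet.pi s.countable_toSet fun j _ => ht j)]
  have e : (fun p : ℝ × (ℕ → ℝ) => Function.update p.2 i p.1) ⁻¹' Set.pi s t =
      (if i ∈ s then t i else Set.univ) ×ˢ Set.pi (s.erase i) t := by
    ext p
    simp only [Set.mem_preimage, Set.mem_pi, Set.mem_prod, Finset.coe_erase, Set.mem_sdiff,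
      Finset.mem_coe, Set.mem_singleton_iff]
    constructor
    · intro H
      refine ⟨?_, fun j hj => by simpa [Function.update_of_ne hj.2] using H j hj.1⟩
      split_ifs with hi
      · simpa using H i hi
      · trivial
    · rintro ⟨H1, H2⟩ j hj
      by_cases hji : j = i
      · subst hji
        rw [if_pos hj] at H1
        simpa using H1
      · rw [Function.update_of_ne hji]
        exact H2 j ⟨hj, hji⟩
  rw [e, Measure.prod_prod, infinitePi_pi _ fun j _ => ht j,
    Finset.prod_congr rfl fun j hj => by rw [← h j (Finset.ne_of_mem_erase hj)]]
  split_ifs with hi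
  · exact Finset.mul_prod_erase s (fun j => P' j (t j)) hi
  · rw [measure_univ, one_mul, Finset.erase_eq_of_notMem hi]

lemma map_truncate_infinitePi (s : Finset ℕ) (h : ∀ i ∈ s, P i = P' i) :
    (infinitePi P).map (fun w i => if i ∈ s then w i else 0) =
      (infinitePi P').map (fun w i => if i ∈ s then w i else 0) := by
  have hm : ∀ i, Measurable fun x : ℝ => if i ∈ s then x else 0 := fun i => by
    split_ifs
    exacts [measurable_id, measurable_const]
  have h1 := infinitePi_map_pi P hm
  have h2 := infinitePi_map_pi P' hm
  rw [h1, h2]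
  congr 1
  ext1 i
  by_cases hi : i ∈ s
  · simp [hi, h i hi]
  · simp [hi]

lemma measurable_truncate (s : Finset ℕ) :
    Measurable fun (w : ℕ → ℝ) i => if i ∈ s then w i else 0 := by
  refine measurable_pi_lambda _ fun i => ?_
  split_ifs
  exacts [measurable_pi_apply i, measurable_const]

lemma integral_infinitePi_congr {s : Finset ℕ} (h : ∀ i ∈ s, P i = P' i) {F : (ℕ → ℝ) → ℝ}
    (hF : Measurable F) (hFs : DependsOn F s) :
    ∫ w, F w ∂infinitePi P = ∫ w, F w ∂infinitePi P' := by
  have e : ∀ w : ℕ → ℝ, F w = F fun i => if i ∈ s then w i else 0 := fun w =>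
    hFs fun i hi => by simp [Finset.mem_coe.1 hi]
  have hm := measurable_truncate s
  calc _ = ∫ w, F (fun i => if i ∈ s then w i else 0) ∂infinitePi P :=
        integral_congr_ae (ae_of_all _ e)
    _ = ∫ w, F (fun i => if i ∈ s then w i else 0) ∂infinitePi P' := by
        rw [← integral_map hm.aemeasurable hF.aestronglyMeasurable, map_truncate_infinitePi s h,
          integral_map hm.aemeasurable hF.aestronglyMeasurable]
    _ = _ := (integral_congr_ae (ae_of_all _ e)).symm

lemma lintegral_infinitePi_congr {s : Finset ℕ} (h : ∀ i ∈ s, P i = P' i)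
    {F : (ℕ → ℝ) → ENNReal} (hF : Measurable F) (hFs : DependsOn F s) :
    ∫⁻ w, F w ∂infinitePi P = ∫⁻ w, F w ∂infinitePi P' := by
  have e : ∀ w : ℕ → ℝ, F w = F fun i => if i ∈ s then w i else 0 := fun w =>
    hFs fun i hi => by simp [Finset.mem_coe.1 hi]
  have hm := measurable_truncate s
  calc _ = ∫⁻ w, F (fun i => if i ∈ s then w i else 0) ∂infinitePi P := lintegral_congr e
    _ = ∫⁻ w, F (fun i => if i ∈ s then w i else 0) ∂infinitePi P' := by
        rw [← lintegral_map hF hm, map_truncate_infinitePi s h, lintegral_map hF hm]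
    _ = _ := (lintegral_congr e).symm

lemma integrable_infinitePi_of_abs_le (hP : ∀ i, Integrable (fun x => x) (P i)) {s : Finset ℕ}
    {C : ℝ} {F : (ℕ → ℝ) → ℝ} (hF : Measurable F) (hb : ∀ w, |F w| ≤ C + ∑ a ∈ s, |w a|) :
    Integrable F (infinitePi P) := by
  refine Integrable.mono' ((integrable_const C).add (integrable_finsetSum s fun a _ => ?_))
    hF.aestronglyMeasurable (ae_of_all _ hb)
  exact ((measurePreserving_eval_infinitePi P a).integrable_comp
    (hP a).abs.aestronglyMeasurable).2 (hP a).abs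

lemma integral_infinitePi_eq_update (i : ℕ) (h : ∀ j, j ≠ i → P' j = P j) {F : (ℕ → ℝ) → ℝ}
    (hF : Measurable F) (hint : Integrable F (infinitePi P')) :
    Integrable (fun w => ∫ x, F (Function.update w i x) ∂P' i) (infinitePi P) ∧
      ∫ w, F w ∂infinitePi P' = ∫ w, ∫ x, F (Function.update w i x) ∂P' i ∂infinitePi P := by
  have e := map_update_prod_infinitePi i h
  have hm := measurable_update_prod i
  rw [← e, integrable_map_measure hF.aestronglyMeasurable hm.aemeasurable] at hint
  refine ⟨hint.integral_prod_right, ?_⟩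
  rw [← e, integral_map hm.aemeasurable hF.aestronglyMeasurable]
  exact integral_prod_symm _ hint

/-- Lindeberg replacement: the law is switched from `μ` to `ν` one coordinate of `s` at a time
through the hybrid measures `R r`, each switch increasing the integral by the one-site hypothesis.
-/
lemma integral_infinitePi_le {μ ν : Measure ℝ} [IsProbabilityMeasure μ] [IsProbabilityMeasure ν]
    (hμ : Integrable (fun x => x) μ) (hν : Integrable (fun x => x) ν) {s : Finset ℕ} {C : ℝ}
    {F : (ℕ → ℝ) → ℝ} (hF : Measurable F) (hb : ∀ w, |F w| ≤ C + ∑ a ∈ s, |w a|)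
    (hFs : DependsOn F s)
    (h : ∀ w, ∀ i ∈ s, ∫ x, F (Function.update w i x) ∂μ ≤ ∫ x, F (Function.update w i x) ∂ν) :
    ∫ w, F w ∂infinitePi (fun _ => μ) ≤ ∫ w, F w ∂infinitePi (fun _ => ν) := by
  set R : Finset ℕ → ℕ → Measure ℝ := fun r i => if i ∈ r then ν else μ with hR
  have hprob : ∀ r i, IsProbabilityMeasure (R r i) := fun r i => by
    simp only [hR]
    split_ifs <;> infer_instance
  have hRint : ∀ r, Integrable F (infinitePi (R r)) := fun r =>
    integrable_infinitePi_of_abs_le (fun i => by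
      simp only [hR]
      split_ifs
      exacts [hν, hμ]) hF hb
  have key : ∀ r ⊆ s, ∫ w, F w ∂infinitePi (fun _ => μ) ≤ ∫ w, F w ∂infinitePi (R r) := by
    intro r
    induction r using Finset.induction_on with
    | empty =>
      intro _
      simp [hR]
    | insert i r hi ih =>
      intro hs
      refine (ih ((Finset.subset_insert i r).trans hs)).trans ?_
      obtain ⟨i1, e1⟩ := integral_infinitePi_eq_update (P := R r) (P' := R r) i
        (fun _ _ => rfl) hF (hRint r)
      obtain ⟨i2, e2⟩ := integral_infinitePi_eq_update (P := R r) (P' := R (insert i r)) i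
        (fun j hj => by simp [hR, hj]) hF (hRint _)
      rw [e1, e2]
      refine integral_mono i1 i2 fun w => ?_
      have := h w i (hs (Finset.mem_insert_self i r))
      simpa [hR, hi] using this
  refine (key s subset_rfl).trans (le_of_eq ?_)
  exact integral_infinitePi_congr (fun i hi => by simp [hR, hi]) hF hFs

/-- The infinite products may be mutually singular, so the density is taken only over the finitely
many coordinates that `F` sees. The coordinates are tilted one by one. -/
lemma lintegral_infinitePi_withDensity {μ : Measure ℝ} [IsProbabilityMeasure μ]
    {ρ : ℝ → ENNReal} (hρ : Measurable ρ) [IsProbabilityMeasure (μ.withDensity ρ)]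
    {s : Finset ℕ} {F : (ℕ → ℝ) → ENNReal} (hF : Measurable F) (hFs : DependsOn F s) :
    ∫⁻ w, F w ∂infinitePi (fun _ => μ.withDensity ρ) =
      ∫⁻ w, F w * ∏ a ∈ s, ρ (w a) ∂infinitePi (fun _ => μ) := by
  set R : Finset ℕ → ℕ → Measure ℝ := fun r i => if i ∈ r then μ.withDensity ρ else μ with hR
  have hprob : ∀ r i, IsProbabilityMeasure (R r i) := fun r i => by
    simp only [hR]
    split_ifs <;> infer_instance
  have key : ∀ (r : Finset ℕ) (F : (ℕ → ℝ) → ENNReal), Measurable F →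
      ∫⁻ w, F w ∂infinitePi (R r) = ∫⁻ w, F w * ∏ a ∈ r, ρ (w a) ∂infinitePi (fun _ => μ) := by
    intro r
    induction r using Finset.induction_on with
    | empty =>
      intro F hF
      simp [hR]
    | insert i r hi ih =>
      intro F hF
      have hm := measurable_update_prod i
      have hFρ : Measurable fun w : ℕ → ℝ => F w * ρ (w i) :=
        hF.mul (hρ.comp (measurable_pi_apply i))
      have e1 := map_update_prod_infinitePi (P := R r) (P' := R r) i fun _ _ => rfl
      have e2 := map_update_prod_infinitePi (P := R r) (P' := R (insert i r)) i
        (fun j hj => by simp [hR, hj])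
      have h1 : R r i = μ := by simp [hR, hi]
      have h2 : R (insert i r) i = μ.withDensity ρ := by simp [hR]
      rw [h1] at e1
      rw [h2] at e2
      have step : ∫⁻ w, F w ∂infinitePi (R (insert i r)) =
          ∫⁻ w, F w * ρ (w i) ∂infinitePi (R r) := by
        have hl : ∀ (ν : Measure ℝ) [SFinite ν] (G : (ℕ → ℝ) → ENNReal), Measurable G →
            ∫⁻ w, G w ∂((ν.prod (infinitePi (R r))).map fun p => Function.update p.2 i p.1) =
              ∫⁻ w, ∫⁻ x, G (Function.update w i x) ∂ν ∂infinitePi (R r) := fun ν _ G hG => by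
          rw [lintegral_map hG hm]
          exact lintegral_prod_symm _ (hG.comp hm).aemeasurable
        rw [← e2, hl _ F hF]
        conv_rhs => rw [← e1, hl _ _ hFρ]
        refine lintegral_congr fun w => ?_
        have hFx : Measurable fun x => F (Function.update w i x) :=
          hF.comp (hm.comp (measurable_id.prodMk measurable_const))
        rw [lintegral_withDensity_eq_lintegral_mul _ hρ hFx]
        refine lintegral_congr fun x => ?_
        simp [mul_comm]
      rw [step, ih _ hFρ]
      refine lintegral_congr fun w => ?_
      rw [Finset.prod_insert hi, mul_assoc]
  rw [← key s F hF]
  exact (lintegral_infinitePi_congr (fun i hi => by simp [hR, hi]) hF hFs).symm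

lemma map_shift_infinitePi (μ : Measure ℝ) [IsProbabilityMeasure μ] (m : ℕ) :
    MeasurePreserving (fun (w : ℕ → ℝ) a => w (a + m)) (infinitePi fun _ => μ)
      (infinitePi fun _ => μ) :=
  ⟨measurable_pi_lambda _ fun _ => measurable_pi_apply _,
    map_infinitePi_infinitePi_of_inj (P := fun _ : ℕ => μ) (add_left_injective m)⟩

end productMeasure

/-! ### Tilting the law of one charge -/

section tilt

/-- The centered indicator function of the positive half-line. -/
noncomputable def centeredSign (μ : Measure ℝ) (x : ℝ) : ℝ :=
  (Set.Ioi (0 : ℝ)).indicator 1 x - μ.real (Set.Ioi 0)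

/-- A bounded density with respect to `μ` which favours positive values. -/
noncomputable def tiltDensity (μ : Measure ℝ) (δ x : ℝ) : ℝ := 1 + δ * centeredSign μ x

/-- The measure `μ` tilted in favour of positive values. -/
noncomputable def tilt (μ : Measure ℝ) (δ : ℝ) : Measure ℝ :=
  μ.withDensity fun x => ENNReal.ofReal (tiltDensity μ δ x)

variable {μ : Measure ℝ}

lemma measurable_centeredSign : Measurable (centeredSign μ) :=
  (measurable_one.indicator measurableSet_Ioi).sub_const _

lemma measurable_tiltDensity (δ : ℝ) : Measurable (tiltDensity μ δ) :=
  (measurable_centeredSign.const_mul δ).const_add 1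

variable [IsProbabilityMeasure μ]

lemma abs_centeredSign_le (x : ℝ) : |centeredSign μ x| ≤ 1 := by
  have h0 : 0 ≤ μ.real (Set.Ioi 0) := measureReal_nonneg
  have h1 : μ.real (Set.Ioi 0) ≤ 1 := measureReal_le_one
  rw [centeredSign, abs_le]
  by_cases hx : x ∈ Set.Ioi (0 : ℝ)
  · rw [Set.indicator_of_mem hx, Pi.one_apply]
    constructor <;> linarith
  · rw [Set.indicator_of_notMem hx]
    constructor <;> linarith

lemma integrable_centeredSign : Integrable (centeredSign μ) μ :=
  Integrable.of_bound measurable_centeredSign.aestronglyMeasurable 1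
    (ae_of_all _ fun x => abs_centeredSign_le x)

lemma integral_centeredSign : ∫ x, centeredSign μ x ∂μ = 0 := by
  simp only [centeredSign]
  have hi : Integrable ((Set.Ioi (0 : ℝ)).indicator (1 : ℝ → ℝ)) μ :=
    (integrable_const (1 : ℝ)).indicator measurableSet_Ioi
  rw [integral_sub hi (integrable_const _),
    integral_indicator_one measurableSet_Ioi]
  simp

lemma tiltDensity_bounds {δ : ℝ} (h0 : 0 ≤ δ) (h1 : δ ≤ 1 / 2) (x : ℝ) :
    1 / 2 ≤ tiltDensity μ δ x ∧ tiltDensity μ δ x ≤ 3 / 2 := by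
  have := abs_le.1 (abs_centeredSign_le (μ := μ) x)
  rw [tiltDensity]
  constructor <;> nlinarith

lemma integral_tilt {δ : ℝ} (h0 : 0 ≤ δ) (h1 : δ ≤ 1 / 2) (g : ℝ → ℝ) :
    ∫ x, g x ∂tilt μ δ = ∫ x, tiltDensity μ δ x * g x ∂μ := by
  rw [tilt, integral_withDensity_eq_integral_toReal_smul
    (measurable_tiltDensity δ).ennreal_ofReal (ae_of_all _ fun _ => ENNReal.ofReal_lt_top)]
  refine integral_congr_ae (ae_of_all _ fun x => ?_)
  dsimp only
  rw [ENNReal.toReal_ofReal (by linarith [(tiltDensity_bounds (μ := μ) h0 h1 x).1]), smul_eq_mul]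

lemma isProbabilityMeasure_tilt {δ : ℝ} (h0 : 0 ≤ δ) (h1 : δ ≤ 1 / 2) :
    IsProbabilityMeasure (tilt μ δ) := by
  refine ⟨?_⟩
  have hi : Integrable (tiltDensity μ δ) μ :=
    (integrable_const 1).add (integrable_centeredSign.const_mul δ)
  rw [tilt, withDensity_apply _ MeasurableSet.univ, Measure.restrict_univ,
    ← ofReal_integral_eq_lintegral_ofReal hi
      (ae_of_all _ fun x => by
        show (0 : ℝ) ≤ _
        linarith [(tiltDensity_bounds (μ := μ) h0 h1 x).1])]
  simp only [tiltDensity]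
  rw [integral_add (integrable_const _) (integrable_centeredSign.const_mul δ),
    integral_const_mul, integral_centeredSign]
  simp

lemma integrable_tilt {δ : ℝ} (h0 : 0 ≤ δ) (h1 : δ ≤ 1 / 2) {g : ℝ → ℝ} (hg : Integrable g μ) :
    Integrable g (tilt μ δ) := by
  rw [tilt, integrable_withDensity_iff_integrable_smul'
    (measurable_tiltDensity δ).ennreal_ofReal (ae_of_all _ fun _ => ENNReal.ofReal_lt_top)]
  simp only [smul_eq_mul]
  refine hg.bdd_mul (c := 3 / 2)
    (measurable_tiltDensity δ).ennreal_ofReal.ennreal_toReal.aestronglyMeasurable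
    (ae_of_all _ fun x => ?_)
  have := tiltDensity_bounds (μ := μ) h0 h1 x
  rw [ENNReal.toReal_ofReal (by linarith), Real.norm_eq_abs, abs_of_nonneg (by linarith)]
  exact this.2

/-- The relative entropy of the tilted measure is quadratic in the size of the tilt. -/
lemma integral_log_tiltDensity_le {δ : ℝ} (h0 : 0 ≤ δ) (h1 : δ ≤ 1 / 2) :
    ∫ x, Real.log (tiltDensity μ δ x) ∂tilt μ δ ≤ δ ^ 2 := by
  have hb := tiltDensity_bounds (μ := μ) h0 h1
  have hc := abs_centeredSign_le (μ := μ)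
  have hsq : Integrable (fun x => centeredSign μ x ^ 2) μ :=
    Integrable.of_bound (measurable_centeredSign.pow_const 2).aestronglyMeasurable 1
      (ae_of_all _ fun x => by
        rw [Real.norm_eq_abs, abs_pow]
        exact pow_le_one₀ (abs_nonneg _) (hc x))
  have hlog : ∀ x, |Real.log (tiltDensity μ δ x)| ≤ 1 := by
    intro x
    have h2 := Real.log_le_sub_one_of_pos (show 0 < tiltDensity μ δ x by linarith [(hb x).1])
    have h3 := Real.one_sub_inv_le_log_of_pos (show 0 < tiltDensity μ δ x by linarith [(hb x).1])
    have h4 : (tiltDensity μ δ x)⁻¹ ≤ 2 := by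
      rw [inv_le_comm₀ (by linarith [(hb x).1]) two_pos]
      linarith [(hb x).1]
    rw [abs_le]
    constructor <;> linarith [(hb x).2]
  rw [integral_tilt h0 h1]
  have hint : Integrable (fun x => tiltDensity μ δ x * Real.log (tiltDensity μ δ x)) μ := by
    refine Integrable.of_bound ((measurable_tiltDensity δ).mul
      (Real.measurable_log.comp (measurable_tiltDensity δ))).aestronglyMeasurable (3 / 2)
      (ae_of_all _ fun x => ?_)
    rw [Real.norm_eq_abs, abs_mul, abs_of_nonneg (by linarith [(hb x).1])]
    nlinarith [hlog x, (hb x).2, (hb x).1, abs_nonneg (Real.log (tiltDensity μ δ x))]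
  -- With `v = 1 + δφ`, the bound `v log v ≤ v (v - 1)` equals `δφ + δ²φ²`, whose linear part has
  -- mean zero.
  calc _ ≤ ∫ x, (δ * centeredSign μ x + δ ^ 2 * centeredSign μ x ^ 2) ∂μ := by
        refine integral_mono hint
          ((integrable_centeredSign.const_mul δ).add (hsq.const_mul _)) fun x => ?_
        have h2 := Real.log_le_sub_one_of_pos (show 0 < tiltDensity μ δ x by linarith [(hb x).1])
        have h3 := mul_le_mul_of_nonneg_left h2
          (show 0 ≤ tiltDensity μ δ x by linarith [(hb x).1])
        refine h3.trans (le_of_eq ?_)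
        rw [tiltDensity]
        ring
    _ = δ ^ 2 * ∫ x, centeredSign μ x ^ 2 ∂μ := by
        rw [integral_add (integrable_centeredSign.const_mul δ) (hsq.const_mul _),
          integral_const_mul, integral_const_mul, integral_centeredSign]
        ring
    _ ≤ δ ^ 2 * ∫ x, 1 ∂μ := by
        refine mul_le_mul_of_nonneg_left (integral_mono hsq (integrable_const 1) fun x => ?_)
          (sq_nonneg δ)
        dsimp only
        rw [← sq_abs]
        exact pow_le_one₀ (abs_nonneg _) (hc x)
    _ = δ ^ 2 := by simp

/-- Otherwise the charge is almost surely nonpositive with mean zero, hence almost surely zero,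
against the positive variance. -/
lemma exists_measure_Ioi_pos (hint : Integrable (fun x => x) μ) (hmean : ∫ x, x ∂μ = 0)
    (hvar : 0 < ∫ x, x ^ 2 ∂μ) : ∃ b, 0 < b ∧ 0 < μ.real (Set.Ioi b) := by
  by_contra! hcon
  have h1 : μ (Set.Ioi 0) = 0 := by
    have e : Set.Ioi (0 : ℝ) = ⋃ n : ℕ, Set.Ioi (1 / ((n : ℝ) + 1)) := by
      ext x
      simp only [Set.mem_Ioi, Set.mem_iUnion]
      exact ⟨fun h => exists_nat_one_div_lt h, fun ⟨n, hn⟩ => lt_trans (by positivity) hn⟩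
    rw [e, measure_iUnion_null_iff]
    intro n
    exact (measureReal_eq_zero_iff).1 (le_antisymm (hcon _ (by positivity)) measureReal_nonneg)
  have h2 : ∀ᵐ x ∂μ, x ≤ 0 := by
    rw [ae_iff]
    simpa [Set.Ioi, not_le] using h1
  have h3 : (fun x : ℝ => -x) =ᵐ[μ] 0 := by
    rw [← integral_eq_zero_iff_of_nonneg_ae (h2.mono fun x hx => neg_nonneg.2 hx) hint.neg,
      integral_neg, hmean, neg_zero]
  have h4 : ∫ x, x ^ 2 ∂μ = 0 := by
    refine integral_eq_zero_of_ae (h3.mono fun x hx => ?_)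
    simp only [Pi.zero_apply, neg_eq_zero] at hx
    simp [hx]
  linarith

lemma measureReal_Ioi_zero_lt_one (hint : Integrable (fun x => x) μ) (hmean : ∫ x, x ∂μ = 0) :
    μ.real (Set.Ioi 0) < 1 := by
  refine lt_of_le_of_ne measureReal_le_one fun h => ?_
  have h1 : ∀ᵐ x ∂μ, x ∈ Set.Ioi (0 : ℝ) :=
    (mem_ae_iff_prob_eq_one measurableSet_Ioi).2 ((ENNReal.toReal_eq_one_iff _).1 h)
  have h2 : (fun x : ℝ => x) =ᵐ[μ] 0 := by
    rw [← integral_eq_zero_iff_of_nonneg_ae (h1.mono fun x hx => le_of_lt hx) hint, hmean]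
  obtain ⟨x, hx1, hx2⟩ := (h1.and h2).exists
  simp only [Set.mem_Ioi, Pi.zero_apply] at hx1 hx2
  linarith

lemma abs_log_add_mul_exp_le {A B : ℝ} (hA : 0 ≤ A) (hB : 0 ≤ B) (hAB : 0 < A + B) (x : ℝ) :
    |Real.log (A + B * Real.exp x)| ≤ |Real.log (A + B)| + |x| := by
  have h1 : 1 ≤ Real.exp |x| := Real.one_le_exp (abs_nonneg x)
  have h2 : Real.exp (-|x|) ≤ 1 := Real.exp_le_one_iff.2 (neg_nonpos.2 (abs_nonneg x))
  have h3 : Real.exp x ≤ Real.exp |x| := Real.exp_le_exp.2 (le_abs_self x)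
  have h4 : Real.exp (-|x|) ≤ Real.exp x := Real.exp_le_exp.2 (neg_abs_le x)
  have hup : A + B * Real.exp x ≤ Real.exp |x| * (A + B) := by nlinarith
  have hlo : Real.exp (-|x|) * (A + B) ≤ A + B * Real.exp x := by nlinarith
  have hpos : 0 < A + B * Real.exp x :=
    (mul_pos (Real.exp_pos _) hAB).trans_le hlo
  have h5 := Real.log_le_log hpos hup
  have h6 := Real.log_le_log (mul_pos (Real.exp_pos _) hAB) hlo
  rw [Real.log_mul (Real.exp_pos _).ne' hAB.ne', Real.log_exp] at h5 h6
  have h7 := le_abs_self (Real.log (A + B))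
  have h8 := neg_abs_le (Real.log (A + B))
  rw [abs_le]
  constructor <;> linarith

/-- The effect of a tilt of the charge at one site dominates the effect of a small shift. -/
lemma exists_integral_log_shift_le (hint : Integrable (fun x => x) μ) (hmean : ∫ x, x ∂μ = 0)
    (hvar : 0 < ∫ x, x ^ 2 ∂μ) : ∃ c, 0 < c ∧ ∀ δ, 0 ≤ δ → δ ≤ 1 / 2 → ∀ A B : ℝ, 0 ≤ A →
      0 ≤ B → 0 < A + B → ∫ x, Real.log (A + B * Real.exp (x + c * δ)) ∂μ ≤
        ∫ x, Real.log (A + B * Real.exp x) ∂tilt μ δ := by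
  obtain ⟨b, hb, hr⟩ := exists_measure_Ioi_pos hint hmean hvar
  have hq := measureReal_Ioi_zero_lt_one hint hmean
  have hq0 : 0 ≤ μ.real (Set.Ioi 0) := measureReal_nonneg
  set q := μ.real (Set.Ioi 0) with hqdef
  set r := μ.real (Set.Ioi b) with hrdef
  have he : Real.exp (-b) < 1 := Real.exp_lt_one_iff.2 (neg_lt_zero.2 hb)
  have he0 := Real.exp_pos (-b)
  -- Chosen so that the upper bound `2cδ(1 + r⁻¹)m` for the effect of the shift equals the lower
  -- bound `δ(1 - q)(1 - exp (-b))m` for the effect of the tilt.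
  set c := (1 - q) * (1 - Real.exp (-b)) / (2 * (1 + r⁻¹)) with hc
  have hrinv : 0 < r⁻¹ := inv_pos.2 hr
  have hc0 : 0 < c := div_pos (mul_pos (by linarith) (by linarith)) (by linarith)
  have hc1 : c ≤ 1 := by
    rw [hc, div_le_one (by linarith)]
    nlinarith
  refine ⟨c, hc0, fun δ h0 h1 A B hA hB hAB => ?_⟩
  set g : ℝ → ℝ := fun x => Real.log (A + B * Real.exp x) with hg
  have hD : ∀ x, 0 < A + B * Real.exp x := by
    intro x
    rcases hA.lt_or_eq with h | h
    · exact add_pos_of_pos_of_nonneg h (mul_nonneg hB (Real.exp_pos x).le)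
    · exact add_pos_of_nonneg_of_pos hA (mul_pos (by linarith) (Real.exp_pos x))
  -- `σ` is the derivative of `g`, the contact probability of the site as a function of its charge.
  -- Both effects are measured against it.
  set σ : ℝ → ℝ := fun x => B * Real.exp x / (A + B * Real.exp x) with hσ
  have hσ0 : ∀ x, 0 ≤ σ x := fun x =>
    div_nonneg (mul_nonneg hB (Real.exp_pos x).le) (hD x).le
  have hσ1 : ∀ x, σ x ≤ 1 := fun x => (div_le_one (hD x)).2 (by linarith)
  have hσm : Monotone σ := by
    intro x y hxy
    simp only [hσ]
    rw [div_le_div_iff₀ (hD x) (hD y)]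
    have := mul_le_mul_of_nonneg_left (Real.exp_le_exp.2 hxy) (mul_nonneg hA hB)
    nlinarith
  have hgm : Monotone g := fun x y hxy => Real.log_le_log (hD x)
    (by have := mul_le_mul_of_nonneg_left (Real.exp_le_exp.2 hxy) hB; linarith)
  -- Used with `s = cδ` for the shift, and with `s = -x` to bound `g x - g 0` from below by `(1 -
  -- exp (-x)) σ x`.
  have hinc : ∀ x s, g (x + s) - g x ≤ (Real.exp s - 1) * σ x := by
    intro x s
    simp only [hg]
    rw [← Real.log_div (hD _).ne' (hD x).ne']
    refine (Real.log_le_sub_one_of_pos (div_pos (hD _) (hD x))).trans (le_of_eq ?_)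
    simp only [hσ]
    have := (hD x).ne'
    rw [Real.exp_add]
    field_simp
    ring
  have hgmeas : Measurable g :=
    Real.measurable_log.comp ((Real.measurable_exp.const_mul B).const_add A)
  have hσmeas : Measurable σ := hσm.measurable
  have hgint : Integrable g μ :=
    ((integrable_const _).add hint.abs).mono' hgmeas.aestronglyMeasurable
      (ae_of_all _ fun x => abs_log_add_mul_exp_le hA hB hAB x)
  have hσint : Integrable σ μ := Integrable.of_bound hσmeas.aestronglyMeasurable 1
    (ae_of_all _ fun x => by rw [Real.norm_eq_abs, abs_of_nonneg (hσ0 x)]; exact hσ1 x)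
  set m := ∫ x in Set.Ioi b, σ x ∂μ with hm
  have hm0 : 0 ≤ m := integral_nonneg fun x => hσ0 x
  -- the total contact fraction is controlled by the one above `b`
  have hσb : σ b * r ≤ m := by
    have := setIntegral_mono_on (μ := μ) (s := Set.Ioi b) (f := fun _ => σ b) (g := σ)
      (integrable_const _).integrableOn hσint.integrableOn measurableSet_Ioi
      fun x hx => hσm (le_of_lt hx)
    rwa [setIntegral_const, smul_eq_mul, mul_comm] at this
  have hσtot : ∫ x, σ x ∂μ ≤ (1 + r⁻¹) * m := by
    have h2 : ∫ x, σ x ∂μ ≤ ∫ x, ((Set.Ioi b).indicator σ x + σ b) ∂μ := by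
      refine integral_mono hσint ((hσint.indicator measurableSet_Ioi).add (integrable_const _))
        fun x => ?_
      by_cases hx : x ∈ Set.Ioi b
      · dsimp only
        rw [Set.indicator_of_mem hx]
        linarith [hσ0 b]
      · dsimp only
        rw [Set.indicator_of_notMem hx, zero_add]
        exact hσm (not_lt.1 hx)
    rw [integral_add (hσint.indicator measurableSet_Ioi) (integrable_const _),
      integral_indicator measurableSet_Ioi, integral_const, probReal_univ, one_smul] at h2
    have h3 : σ b ≤ r⁻¹ * m := by
      rw [inv_mul_eq_div, le_div_iff₀ hr]
      exact hσb
    linarith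
  -- the effect of the tilt
  have hφg : (1 - q) * (1 - Real.exp (-b)) * m ≤ ∫ x, centeredSign μ x * g x ∂μ := by
    have hbd : ∀ f : ℝ → ℝ, Integrable f μ → Integrable (fun x => centeredSign μ x * f x) μ :=
      fun f hf => hf.bdd_mul measurable_centeredSign.aestronglyMeasurable
        (ae_of_all _ fun x => abs_centeredSign_le x)
    -- Since `φ` has mean zero, `g 0` may be subtracted. Then `φ x` and `g x - g 0` have the same
    -- sign by monotonicity, and everything outside `x > b` can be dropped.
    have h2 : ∫ x, centeredSign μ x * g x ∂μ = ∫ x, centeredSign μ x * (g x - g 0) ∂μ := by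
      simp_rw [mul_sub]
      rw [integral_sub (hbd g hgint) (integrable_centeredSign.mul_const _), integral_mul_const,
        integral_centeredSign]
      ring
    rw [h2, hm, ← integral_indicator measurableSet_Ioi, ← integral_const_mul]
    refine integral_mono ((hσint.indicator measurableSet_Ioi).const_mul _)
      (hbd _ (hgint.sub (integrable_const _))) fun x => ?_
    dsimp only
    by_cases hx : x ∈ Set.Ioi b
    · have hx' : b < x := hx
      have hx0 : x ∈ Set.Ioi (0 : ℝ) := hb.trans hx'
      rw [Set.indicator_of_mem hx, centeredSign, Set.indicator_of_mem hx0, Pi.one_apply, mul_assoc]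
      refine mul_le_mul_of_nonneg_left ?_ (by linarith)
      have h3 := hinc x (-x)
      rw [add_neg_cancel] at h3
      have h4 : Real.exp (-x) ≤ Real.exp (-b) := Real.exp_le_exp.2 (by linarith)
      nlinarith [hσ0 x]
    · rw [Set.indicator_of_notMem hx, mul_zero, centeredSign]
      by_cases hx0 : x ∈ Set.Ioi (0 : ℝ)
      · rw [Set.indicator_of_mem hx0, Pi.one_apply]
        exact mul_nonneg (by linarith) (sub_nonneg.2 (hgm (le_of_lt hx0)))
      · rw [Set.indicator_of_notMem hx0]
        exact mul_nonneg_of_nonpos_of_nonpos (by linarith) (sub_nonpos.2 (hgm (not_lt.1 hx0)))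
  have htilt : ∫ x, g x ∂tilt μ δ = ∫ x, g x ∂μ + δ * ∫ x, centeredSign μ x * g x ∂μ := by
    rw [integral_tilt h0 h1, ← integral_const_mul, ← integral_add hgint
      ((hgint.bdd_mul measurable_centeredSign.aestronglyMeasurable
        (ae_of_all _ fun x => abs_centeredSign_le x)).const_mul δ)]
    refine integral_congr_ae (ae_of_all _ fun x => ?_)
    simp only [tiltDensity]
    ring
  -- the effect of the shift
  have hs0 : 0 ≤ c * δ := mul_nonneg hc0.le h0
  have hs1 : c * δ ≤ 1 := by nlinarith
  have hexp : Real.exp (c * δ) - 1 ≤ 2 * (c * δ) := by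
    have := Real.abs_exp_sub_one_le (x := c * δ) (by rwa [abs_of_nonneg hs0])
    rw [abs_of_nonneg hs0] at this
    exact (le_abs_self _).trans this
  have hshift : ∫ x, g (x + c * δ) ∂μ ≤ ∫ x, (g x + 2 * (c * δ) * σ x) ∂μ := by
    refine integral_mono ?_ (hgint.add (hσint.const_mul _)) fun x => ?_
    · refine ((integrable_const _).add (hint.add (integrable_const (c * δ))).abs).mono'
        (hgmeas.comp (measurable_add_const _)).aestronglyMeasurable
        (ae_of_all _ fun x => abs_log_add_mul_exp_le hA hB hAB (x + c * δ))
    · have h2 := hinc x (c * δ)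
      have h3 := mul_le_mul_of_nonneg_right hexp (hσ0 x)
      dsimp only
      linarith
  rw [integral_add hgint (hσint.const_mul _), integral_const_mul] at hshift
  have hfin : 2 * (c * δ) * ∫ x, σ x ∂μ ≤ δ * ((1 - q) * (1 - Real.exp (-b)) * m) := by
    calc _ ≤ 2 * (c * δ) * ((1 + r⁻¹) * m) := mul_le_mul_of_nonneg_left hσtot (by linarith)
      _ = δ * ((c * (2 * (1 + r⁻¹))) * m) := by ring
      _ = _ := by rw [hc, div_mul_cancel₀ _ (by positivity)]
  have := mul_le_mul_of_nonneg_left hφg h0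
  rw [htilt]
  linarith

end tilt

/-! ### Quenched means, superadditivity and existence of the free energy -/

section freeEnergy

open Measure

/-- The logarithm of the partition function with charges `w` and pinning reward `h`. -/
noncomputable def logSum (K : ℕ → ℝ) (n : ℕ) (h : ℝ) (w : ℕ → ℝ) : ℝ :=
  Real.log (renewalSum K n fun a => h + w a)

/-- The quenched mean of `logSum` when the charges are independent with law `μ`. -/
noncomputable def meanLogSum (K : ℕ → ℝ) (μ : Measure ℝ) (n : ℕ) (h : ℝ) : ℝ :=
  ∫ w, logSum K n h w ∂infinitePi fun _ => μ

/-- The standing assumptions on the inter-arrival weights. -/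
structure IsRenewalWeight (K : ℕ → ℝ) : Prop where
  nonneg : ∀ t, 0 ≤ K t
  pos : ∀ t, 1 ≤ t → 0 < K t
  sum_le_one : ∀ n, ∑ t ∈ Finset.Icc 1 n, K t ≤ 1

lemma integral_eval {μ : Measure ℝ} [IsProbabilityMeasure μ] (a : ℕ) {f : ℝ → ℝ} (hf : Integrable f μ) :
    Integrable (fun w : ℕ → ℝ => f (w a)) (infinitePi fun _ => μ) ∧
      ∫ w : ℕ → ℝ, f (w a) ∂infinitePi (fun _ => μ) = ∫ x, f x ∂μ := by
  have hp := measurePreserving_eval_infinitePi (fun _ : ℕ => μ) a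
  refine ⟨(hp.integrable_comp hf.aestronglyMeasurable).2 hf, ?_⟩
  conv_rhs => rw [← hp.map_eq]
  rw [integral_map hp.measurable.aemeasurable (by rw [hp.map_eq]; exact hf.aestronglyMeasurable)]

variable {K : ℕ → ℝ} (hK : IsRenewalWeight K)

lemma measurable_logSum (n : ℕ) (h : ℝ) : Measurable (logSum K n h) :=
  Real.measurable_log.comp ((continuous_renewalSum n).measurable.comp
    (measurable_pi_lambda _ fun a => measurable_const.add (measurable_pi_apply a)))

lemma dependsOn_logSum (n : ℕ) (h : ℝ) : DependsOn (logSum K n h) (Finset.Icc 1 n) := by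
  intro w w' hw
  simp only [logSum]
  rw [renewalSum_congr fun a ha => by rw [hw a (Finset.mem_coe.2 ha)]]

include hK

lemma abs_logSum_le (n : ℕ) (h : ℝ) (w : ℕ → ℝ) : |logSum K n h w| ≤
    n * (|Real.log (K 1)| + |h|) + ∑ a ∈ Finset.Icc 1 n, |w a| := by
  refine (abs_log_renewalSum_le hK.nonneg hK.pos hK.sum_le_one n _).trans ?_
  have : ∑ a ∈ Finset.Icc 1 n, |h + w a| ≤ ∑ a ∈ Finset.Icc 1 n, (|h| + |w a|) :=
    Finset.sum_le_sum fun a _ => abs_add_le _ _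
  rw [Finset.sum_add_distrib] at this
  simp only [Finset.sum_const, Nat.card_Icc, Nat.add_sub_cancel, nsmul_eq_mul] at this
  linarith

lemma logSum_add_le (n m : ℕ) (h : ℝ) (w : ℕ → ℝ) :
    logSum K n h w + logSum K m h (fun a => w (a + n)) ≤ logSum K (n + m) h w := by
  have h1 := renewalSum_pos hK.nonneg hK.pos n fun a => h + w a
  have h2 := renewalSum_pos hK.nonneg hK.pos m fun a => h + w (a + n)
  simp only [logSum]
  rw [← Real.log_mul h1.ne' h2.ne']
  exact Real.log_le_log (mul_pos h1 h2) (renewalSum_mul_le hK.nonneg n m fun a => h + w a)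

lemma log_add_le_logSum {n : ℕ} (hn : 1 ≤ n) (h : ℝ) (w : ℕ → ℝ) :
    Real.log (K n) + (h + w n) ≤ logSum K n h w := by
  have h1 := single_jump_le_renewalSum hK.nonneg hn fun a => h + w a
  have h2 := Real.log_le_log (mul_pos (hK.pos n hn) (Real.exp_pos _)) h1
  rwa [Real.log_mul (hK.pos n hn).ne' (Real.exp_pos _).ne', Real.log_exp] at h2

variable {μ : Measure ℝ} [IsProbabilityMeasure μ] (hμ : Integrable (fun x => x) μ)

include hμ

lemma integrable_logSum (n : ℕ) (h : ℝ) : Integrable (logSum K n h) (infinitePi fun _ => μ) :=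
  integrable_infinitePi_of_abs_le (fun _ => hμ) (measurable_logSum n h) (abs_logSum_le hK n h)

lemma meanLogSum_add_le (n m : ℕ) (h : ℝ) :
    meanLogSum K μ n h + meanLogSum K μ m h ≤ meanLogSum K μ (n + m) h := by
  have hs := map_shift_infinitePi μ n
  have hi := integrable_logSum hK hμ m h
  have e : meanLogSum K μ m h =
      ∫ w, logSum K m h (fun a => w (a + n)) ∂infinitePi fun _ => μ := by
    rw [meanLogSum, ← hs.map_eq, integral_map hs.measurable.aemeasurable
      (measurable_logSum m h).aestronglyMeasurable, hs.map_eq]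
  have hi' : Integrable (fun w => logSum K m h fun a => w (a + n)) (infinitePi fun _ => μ) :=
    (hs.integrable_comp (measurable_logSum m h).aestronglyMeasurable).2 hi
  rw [e, meanLogSum, meanLogSum, ← integral_add (integrable_logSum hK hμ n h) hi']
  exact integral_mono ((integrable_logSum hK hμ n h).add hi')
    (integrable_logSum hK hμ _ h) fun w => logSum_add_le hK n m h w

lemma meanLogSum_le (n : ℕ) (h : ℝ) :
    meanLogSum K μ n h ≤ n * (|Real.log (K 1)| + |h| + ∫ x, |x| ∂μ) := by
  have h1 : meanLogSum K μ n h ≤ ∫ w : ℕ → ℝ, (n * (|Real.log (K 1)| + |h|) +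
      ∑ a ∈ Finset.Icc 1 n, |w a|) ∂infinitePi fun _ => μ :=
    integral_mono (integrable_logSum hK hμ n h) ((integrable_const _).add
      (integrable_finsetSum _ fun a _ => (integral_eval a hμ.abs).1))
      fun w => (le_abs_self _).trans (abs_logSum_le hK n h w)
  rw [integral_add (integrable_const _)
    (integrable_finsetSum _ fun a _ => (integral_eval a hμ.abs).1), integral_finsetSum _
    fun a _ => (integral_eval a hμ.abs).1, Finset.sum_congr rfl
    fun a _ => (integral_eval a hμ.abs).2] at h1
  simp only [integral_const, probReal_univ, one_smul, Finset.sum_const, Nat.card_Icc,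
    Nat.add_sub_cancel, nsmul_eq_mul] at h1
  linarith

/-- Existence of the free energy, as a limit and as a supremum. -/
lemma exists_tendsto_meanLogSum (h : ℝ) :
    ∃ f, Tendsto (fun n : ℕ => 1 / (n : ℝ) * meanLogSum K μ n h) atTop (𝓝 f) ∧
      ∀ n : ℕ, meanLogSum K μ n h ≤ n * f := by
  have hsub : Subadditive fun n => -meanLogSum K μ n h := fun m n => by
    have := meanLogSum_add_le hK hμ m n h
    linarith
  have hbdd : BddBelow (Set.range fun n : ℕ => -meanLogSum K μ n h / n) := by
    refine ⟨-(|Real.log (K 1)| + |h| + ∫ x, |x| ∂μ), ?_⟩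
    rintro _ ⟨n, rfl⟩
    have h0 : 0 ≤ |Real.log (K 1)| + |h| + ∫ x, |x| ∂μ :=
      add_nonneg (by positivity) (integral_nonneg fun _ => abs_nonneg _)
    rcases Nat.eq_zero_or_pos n with rfl | hn
    · simp only [Nat.cast_zero, div_zero]
      linarith
    · have hn' : (0 : ℝ) < n := by exact_mod_cast hn
      dsimp only
      rw [le_div_iff₀ hn']
      have := meanLogSum_le hK hμ n h
      linarith
  refine ⟨-hsub.lim, ?_, fun n => ?_⟩
  · refine (hsub.tendsto_lim hbdd).neg.congr fun n => ?_
    ring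
  · rcases Nat.eq_zero_or_pos n with rfl | hn
    · simp [meanLogSum, logSum]
    · have hn' : (0 : ℝ) < n := by exact_mod_cast hn
      have := hsub.lim_le_div hbdd hn.ne'
      rw [le_div_iff₀ hn'] at this
      linarith

lemma meanLogSum_add_const_le (n : ℕ) (h : ℝ) {s : ℝ} (hs : 0 ≤ s) :
    meanLogSum K μ n (h + s) ≤ n * s + meanLogSum K μ n h := by
  have h1 : meanLogSum K μ n (h + s) ≤
      ∫ w, (n * s + logSum K n h w) ∂infinitePi fun _ => μ := by
    refine integral_mono (integrable_logSum hK hμ n _)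
      ((integrable_const _).add (integrable_logSum hK hμ n h)) fun w => ?_
    have hp := renewalSum_pos hK.nonneg hK.pos n fun a => h + w a
    have h2 := renewalSum_add_const_le hK.nonneg n (fun a => h + w a) hs
    have h3 := Real.log_le_log (renewalSum_pos hK.nonneg hK.pos _ _) h2
    rw [Real.log_mul (Real.exp_pos _).ne' hp.ne', Real.log_exp] at h3
    simp only [logSum]
    rwa [show (fun a => h + s + w a) = fun a => s + (h + w a) from funext fun a => by ring]
  rwa [integral_add (integrable_const _) (integrable_logSum hK hμ n h), integral_const,
    probReal_univ, one_smul] at h1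

/-- Obtained from the path visiting every site. It makes the free energy positive for large rewards,
so that `h_c < +∞`. -/
lemma le_meanLogSum (hmean : ∫ x, x ∂μ = 0) (n : ℕ) (h : ℝ) :
    n * (Real.log (K 1) + h) ≤ meanLogSum K μ n h := by
  have h1 : ∫ w : ℕ → ℝ, (n * (Real.log (K 1) + h) + ∑ a ∈ Finset.Icc 1 n, w a)
      ∂(infinitePi fun _ => μ) ≤ meanLogSum K μ n h := by
    refine integral_mono ((integrable_const _).add
      (integrable_finsetSum _ fun a _ => (integral_eval a hμ).1)) (integrable_logSum hK hμ n h)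
      fun w => ?_
    have h2 := Real.log_le_log (mul_pos (pow_pos (hK.pos 1 le_rfl) n) (Real.exp_pos _))
      (pow_mul_exp_le_renewalSum hK.nonneg n fun a => h + w a)
    rw [Real.log_mul (pow_pos (hK.pos 1 le_rfl) n).ne' (Real.exp_pos _).ne', Real.log_pow,
      Real.log_exp, Finset.sum_add_distrib] at h2
    simp only [Finset.sum_const, Nat.card_Icc, Nat.add_sub_cancel, nsmul_eq_mul] at h2
    simp only [logSum]
    linarith
  rw [integral_add (integrable_const _)
    (integrable_finsetSum _ fun a _ => (integral_eval a hμ).1), integral_finsetSum _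
    fun a _ => (integral_eval a hμ).1, Finset.sum_congr rfl
    fun a _ => (integral_eval a hμ).2, hmean] at h1
  simpa using h1

end freeEnergy

/-! ### The rare-stretch strategy -/

section rareStretch

open Measure

/-- The logarithmic cost is replaced by its tangent at `d = 1/p`, namely `log d ≤ log p⁻¹ + p d -
1`. Linear costs add up along a path to at most `C p` times the distance covered, so the
distribution of the gaps is never needed. -/
lemma log_jump_ge {K : ℕ → ℝ} {C : ℝ} (hC : 0 ≤ C)
    (hKlog : ∀ t : ℕ, 1 ≤ t → -(C * (1 + Real.log t)) ≤ Real.log (K t)) {M d : ℕ} (hM : 1 ≤ M) (hd : 1 ≤ d) {p : ℝ} (hp : 0 < p) :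
    -(C * (1 + Real.log M + Real.log p⁻¹)) - C * p * d ≤ Real.log (K (d * M)) := by
  have hM' : (0 : ℝ) < M := by exact_mod_cast hM
  have hd' : (0 : ℝ) < d := by exact_mod_cast hd
  have h1 := hKlog (d * M) (Nat.mul_pos hd hM)
  rw [Nat.cast_mul, Real.log_mul hd'.ne' hM'.ne'] at h1
  have h2 : Real.log d ≤ Real.log p⁻¹ + p * d := by
    have h3 := Real.log_le_sub_one_of_pos (mul_pos hp hd')
    rw [Real.log_mul hp.ne' hd'.ne'] at h3
    rw [Real.log_inv]
    linarith
  have h4 := mul_le_mul_of_nonneg_left h2 hC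
  linarith

variable {K : ℕ → ℝ} (hK : IsRenewalWeight K) {C : ℝ} (hC : 0 ≤ C)
  (hKlog : ∀ t : ℕ, 1 ≤ t → -(C * (1 + Real.log t)) ≤ Real.log (K t))

include hK hC hKlog

/-- Extending a partition function by a single jump ending at a multiple of `M`. -/
lemma logSum_jump_ge {M q n : ℕ} (hM : 1 ≤ M) (hq : q ≤ n) {p : ℝ} (hp : 0 < p) (hp1 : p ≤ 1)
    (h : ℝ) (w : ℕ → ℝ) :
    logSum K (q * M) h w - C * (1 + Real.log M + Real.log p⁻¹) - C * p * (n - q : ℕ) - |h|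
      - |w (n * M)| ≤ logSum K (n * M) h w := by
  have hJ : 0 ≤ C * (1 + Real.log M + Real.log p⁻¹) :=
    mul_nonneg hC (add_nonneg (add_nonneg zero_le_one (Real.log_natCast_nonneg M))
      (Real.log_nonneg ((one_le_inv₀ hp).2 hp1)))
  rcases hq.lt_or_eq with hqn | rfl
  · have hd : 1 ≤ n - q := by omega
    have h1 := logSum_add_le hK (q * M) ((n - q) * M) h w
    have h2 := log_add_le_logSum hK (Nat.mul_pos hd hM) h fun a => w (a + q * M)
    have h3 := log_jump_ge hC hKlog hM hd hp
    have e : q * M + (n - q) * M = n * M := by rw [← Nat.add_mul, Nat.add_sub_cancel' hq]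
    rw [e] at h1
    rw [add_comm ((n - q) * M), e] at h2
    have h4 := neg_abs_le h
    have h5 := neg_abs_le (w (n * M))
    linarith
  · have h4 := abs_nonneg h
    have h5 := abs_nonneg (w (q * M))
    simp only [Nat.sub_self, Nat.cast_zero, mul_zero]
    linarith

/-- The strategy which visits only the blocks of length `M` in `A`. -/
lemma exists_logSum_ge {M : ℕ} (hM : 1 ≤ M) {p : ℝ} (hp : 0 < p) (hp1 : p ≤ 1) (h G : ℝ)
    {A : Set (ℕ → ℝ)} (hA : ∀ w ∈ A, G ≤ logSum K M h w) (w : ℕ → ℝ) (n : ℕ) :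
    ∃ q ≤ n, ∑ j ∈ Finset.range n, A.indicator (1 : (ℕ → ℝ) → ℝ) (fun a => w (a + j * M)) *
      (G - C * (1 + Real.log M + Real.log p⁻¹) - |h| - |w (j * M)|) ≤
        logSum K (q * M) h w + C * p * q := by
  -- `q * M` is the end of the last visited block (`0` if there is none), and `C * p * q` accounts
  -- for the linear part of the jump costs so far. Each visit also pays `|h| + |w (j * M)|` for the
  -- landing site.
  induction n with
  | zero => exact ⟨0, le_rfl, by simp [logSum]⟩
  | succ n ih =>
    obtain ⟨q, hq, hle⟩ := ih
    by_cases hn : (fun a => w (a + n * M)) ∈ A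
    · refine ⟨n + 1, le_rfl, ?_⟩
      rw [Finset.sum_range_succ, Set.indicator_of_mem hn, Pi.one_apply, one_mul]
      have h1 := logSum_jump_ge hK hC hKlog hM hq hp hp1 h w
      have h2 := logSum_add_le hK (n * M) M h w
      have h3 := hA _ hn
      rw [show n * M + M = (n + 1) * M by ring] at h2
      rw [Nat.cast_sub hq] at h1
      push_cast
      have h4 := mul_nonneg hC hp.le
      linarith
    · refine ⟨q, hq.trans (Nat.le_succ n), ?_⟩
      rw [Finset.sum_range_succ, Set.indicator_of_notMem hn, zero_mul, add_zero]
      exact hle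

variable {μ : Measure ℝ} [IsProbabilityMeasure μ] (hμ : Integrable (fun x => x) μ)

include hμ

/-- If the free energy is not positive, then rare blocks with a large partition function cannot
compensate for the cost of reaching them. -/
lemma rare_stretch_bound {h : ℝ} (hneg : ∀ n, meanLogSum K μ n h ≤ 0) {M : ℕ} (hM : 1 ≤ M)
    {G : ℝ} {A : Set (ℕ → ℝ)} (hAm : MeasurableSet A)
    (hAdep : DependsOn (A.indicator (1 : (ℕ → ℝ) → ℝ)) (Finset.Icc 1 M))
    (hA : ∀ w ∈ A, G ≤ logSum K M h w) (hp : 0 < (infinitePi fun _ => μ).real A) :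
    G ≤ C * Real.log M + C * Real.log ((infinitePi fun _ => μ).real A)⁻¹ +
      (2 * C + |h| + ∫ x, |x| ∂μ) := by
  set ν : Measure (ℕ → ℝ) := infinitePi fun _ => μ with hν
  set p := ν.real A with hpdef
  set J := C * (1 + Real.log M + Real.log p⁻¹) with hJ
  set E := ∫ x, |x| ∂μ with hE
  have hp1 : p ≤ 1 := measureReal_le_one
  have hCp : 0 ≤ C * p := mul_nonneg hC hp.le
  set f : ℕ → (ℕ → ℝ) → ℝ := fun j w =>
    A.indicator (1 : (ℕ → ℝ) → ℝ) (fun a => w (a + j * M)) with hf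
  have hs : ∀ m, MeasurePreserving (fun (w : ℕ → ℝ) a => w (a + m)) ν ν := map_shift_infinitePi μ
  have hind : Measurable (A.indicator (1 : (ℕ → ℝ) → ℝ)) := measurable_one.indicator hAm
  have hfm : ∀ j, Measurable (f j) := fun j => hind.comp (hs _).measurable
  have hfb : ∀ j w, ‖f j w‖ ≤ 1 := fun j w => by
    simp only [hf, Set.indicator]
    split_ifs <;> simp
  have hfint : ∀ j, Integrable (f j) ν := fun j =>
    Integrable.of_bound (hfm j).aestronglyMeasurable 1 (ae_of_all _ (hfb j))
  have hfE : ∀ j, ∫ w, f j w ∂ν = p := fun j => by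
    have h1 := (hs (j * M)).map_eq
    have h2 : ∫ w, A.indicator (1 : (ℕ → ℝ) → ℝ) w ∂ν = p := integral_indicator_one hAm
    rw [← h1, integral_map (hs _).measurable.aemeasurable hind.aestronglyMeasurable] at h2
    exact h2
  have hw : ∀ j : ℕ, Integrable (fun w : ℕ → ℝ => |w j|) ν ∧ ∫ w, |w j| ∂ν = E := fun j =>
    integral_eval j hμ.abs
  have hfw : ∀ j, Integrable (fun w => f j w * |w (j * M)|) ν := fun j =>
    (hw (j * M)).1.bdd_mul (hfm j).aestronglyMeasurable (ae_of_all _ (hfb j))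
  have hfwE : ∀ j, ∫ w, f j w * |w (j * M)| ∂ν = p * E := fun j => by
    -- The landing site `j * M` lies just before block `j`, which occupies `j * M + 1, …, j * M +
    -- M`; its charge is independent of the block being good.
    have hI : IndepFun (f j) (fun w : ℕ → ℝ => |w (j * M)|) ν := by
      refine indepFun_of_dependsOn (X := fun i (w : ℕ → ℝ) => w i) (s := Set.Ioi (j * M))
        (t := {j * M}) (F := f j) (G := fun w => |w (j * M)|)
        (iIndepFun_infinitePi (P := fun _ : ℕ => μ) (X := fun _ x => x) fun _ => measurable_id)
        (fun i => measurable_pi_apply i) (by simp) (hfm j) (measurable_pi_apply _).abs ?_ ?_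
      · intro x y hxy
        refine hAdep fun a ha => hxy _ ?_
        have := Finset.mem_Icc.1 (Finset.mem_coe.1 ha)
        rw [Set.mem_Ioi]
        omega
      · intro x y hxy
        dsimp only
        rw [hxy _ rfl]
    rw [hI.integral_fun_mul_eq_mul_integral (hfm j).aestronglyMeasurable
      (measurable_pi_apply _).abs.aestronglyMeasurable, hfE, (hw _).2]
  -- Take expectations along the strategy, ended by a jump to `n * M` so that `hneg` applies. Each
  -- of the `n` blocks is good with probability `p`, and the linear cost `C p n` is the term `-C`
  -- inside the bracket. A bound uniform in `n` then forces the bracket to be nonpositive.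
  have hlin : ∀ n : ℕ, n * (p * (G - J - |h| - E - C)) ≤ J + |h| + E := by
    intro n
    have hpt : ∀ w : ℕ → ℝ, ∑ j ∈ Finset.range n, (f j w * (G - J - |h|) - f j w * |w (j * M)|) ≤
        logSum K (n * M) h w + (J + C * p * n + |h|) + |w (n * M)| := by
      intro w
      obtain ⟨q, hq, h1⟩ := exists_logSum_ge hK hC hKlog hM hp hp1 h G hA w n
      have h2 := logSum_jump_ge hK hC hKlog hM hq hp hp1 h w
      rw [Nat.cast_sub hq] at h2
      simp only [← mul_sub]
      linarith
    have hi1 : ∀ j ∈ Finset.range n,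
        Integrable (fun w => f j w * (G - J - |h|) - f j w * |w (j * M)|) ν := fun j _ =>
      ((hfint j).mul_const _).sub (hfw j)
    have hi2 : Integrable (fun w => logSum K (n * M) h w + (J + C * p * n + |h|)) ν :=
      (integrable_logSum hK hμ _ h).add (integrable_const _)
    have h3 := integral_mono (integrable_finsetSum _ hi1) (hi2.add (hw (n * M)).1) hpt
    simp only [Pi.add_apply] at h3
    rw [integral_finsetSum _ hi1, integral_add hi2 (hw (n * M)).1, (hw _).2,
      integral_add (integrable_logSum hK hμ _ h) (integrable_const _), integral_const,
      probReal_univ, one_smul, Finset.sum_congr rfl fun j _ => by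
        rw [integral_sub ((hfint j).mul_const _) (hfw j), integral_mul_const, hfE, hfwE]] at h3
    simp only [Finset.sum_const, Finset.card_range, nsmul_eq_mul] at h3
    have h4 := hneg (n * M)
    rw [meanLogSum] at h4
    linarith
  have hfin : G - J - |h| - E - C ≤ 0 := by
    by_contra! hpos
    obtain ⟨n, hn⟩ := exists_nat_gt ((J + |h| + E) / (p * (G - J - |h| - E - C)))
    rw [div_lt_iff₀ (mul_pos hp hpos)] at hn
    exact absurd (hlin n) (not_le.2 hn)
  rw [hJ] at hfin
  linarith

end rareStretch

/-! ### Probability of stretches with a large partition function -/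

section goodBlocks

open Measure

lemma iIndepFun_eval (μ : Measure ℝ) [IsProbabilityMeasure μ] :
    iIndepFun (fun i (w : ℕ → ℝ) => w i) (infinitePi fun _ => μ) :=
  iIndepFun_infinitePi (P := fun _ : ℕ => μ) (X := fun _ x => x) fun _ => measurable_id

lemma sum_Icc_one_eq_sum_range (f : ℕ → ℝ) (n : ℕ) :
    ∑ a ∈ Finset.Icc 1 n, f a = ∑ j ∈ Finset.range n, f (j + 1) := by
  induction n with
  | zero => simp
  | succ n ih => rw [Finset.sum_Icc_succ_top (by omega), Finset.sum_range_succ, ih]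

lemma dependsOn_indicator {β : Type*} [Zero β] [One β] {E : Set (ℕ → ℝ)} {s : Finset ℕ}
    (h : ∀ w w' : ℕ → ℝ, (∀ a ∈ s, w a = w' a) → (w ∈ E ↔ w' ∈ E)) :
    DependsOn (E.indicator (1 : (ℕ → ℝ) → β)) s := by
  intro w w' hw
  have h1 := h w w' fun a ha => hw a (Finset.mem_coe.2 ha)
  by_cases hE : w ∈ E
  · rw [Set.indicator_of_mem hE, Set.indicator_of_mem (h1.1 hE)]
    rfl
  · rw [Set.indicator_of_notMem hE, Set.indicator_of_notMem fun h' => hE (h1.2 h')]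

/-- The law of large numbers for a function of successive blocks of independent variables. -/
lemma block_strong_law {μ : Measure ℝ} [IsProbabilityMeasure μ] {N : ℕ} {F : (ℕ → ℝ) → ℝ}
    (hF : Measurable F) (hFi : Integrable F (infinitePi fun _ => μ))
    (hFN : DependsOn F (Finset.Icc 1 N)) :
    ∀ᵐ w ∂(infinitePi fun _ => μ), Tendsto (fun k : ℕ =>
      (∑ j ∈ Finset.range k, F fun a => w (a + j * N)) / k) atTop
        (𝓝 (∫ w, F w ∂(infinitePi fun _ => μ))) := by
  have hs := map_shift_infinitePi μ
  have h := strong_law_ae_real (μ := infinitePi fun _ => μ)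
    (fun j (w : ℕ → ℝ) => F fun a => w (a + j * N)) (by simpa using hFi) ?_ ?_
  · simpa using h
  · intro i j hij
    refine indepFun_of_dependsOn (X := fun i (w : ℕ → ℝ) => w i)
      (s := Set.Ioc (i * N) ((i + 1) * N)) (t := Set.Ioc (j * N) ((j + 1) * N))
      (F := fun w => F fun a => w (a + i * N)) (G := fun w => F fun a => w (a + j * N))
      (iIndepFun_eval μ) (fun i => measurable_pi_apply i) ?_ (hF.comp (hs _).measurable)
      (hF.comp (hs _).measurable) ?_ ?_
    · rw [Set.disjoint_left]
      rintro a ⟨h1, h2⟩ ⟨h3, h4⟩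
      rcases lt_or_gt_of_ne hij with h | h
      · exact absurd (h2.trans (Nat.mul_le_mul_right N h)) (not_le.2 h3)
      · exact absurd (h4.trans (Nat.mul_le_mul_right N h)) (not_le.2 h1)
    all_goals
      intro x y hxy
      refine hFN fun a ha => hxy _ ?_
      have := Finset.mem_Icc.1 (Finset.mem_coe.1 ha)
      rw [Set.mem_Ioc, Nat.add_mul]
      omega
  · intro i
    refine ⟨(hF.comp (hs _).measurable).aemeasurable,
      (hF.comp (hs _).measurable).aemeasurable, ?_⟩
    have e : ∀ j, ((infinitePi fun _ => μ).map fun w : ℕ → ℝ => F fun a => w (a + j * N)) =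
        (infinitePi fun _ => μ).map F := fun j => by
      conv_rhs => rw [← (hs (j * N)).map_eq]
      rw [Measure.map_map hF (hs _).measurable]
      rfl
    rw [e, e]

/-- The environments in which `k` successive blocks of length `N` have partition functions with
average growth rate at least `z`. -/
def goodBlocks (K : ℕ → ℝ) (N k : ℕ) (h z : ℝ) : Set (ℕ → ℝ) :=
  {w | (k * N : ℕ) * z ≤ ∑ j ∈ Finset.range k, logSum K N h fun a => w (a + j * N)}

variable {K : ℕ → ℝ}

lemma measurable_sum_logSum (N k : ℕ) (h : ℝ) : Measurable fun w : ℕ → ℝ =>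
    ∑ j ∈ Finset.range k, logSum K N h fun a => w (a + j * N) :=
  Finset.measurable_fun_sum _ fun _ _ => (measurable_logSum N h).comp
    (measurable_pi_lambda _ fun _ => measurable_pi_apply _)

lemma measurableSet_goodBlocks (N k : ℕ) (h z : ℝ) : MeasurableSet (goodBlocks K N k h z) :=
  measurableSet_le measurable_const (measurable_sum_logSum N k h)

lemma dependsOn_goodBlocks (N k : ℕ) (h z : ℝ) {w w' : ℕ → ℝ}
    (hw : ∀ a ∈ Finset.Icc 1 (k * N), w a = w' a) :
    w ∈ goodBlocks K N k h z ↔ w' ∈ goodBlocks K N k h z := by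
  have e : ∑ j ∈ Finset.range k, (logSum K N h fun a => w (a + j * N)) =
      ∑ j ∈ Finset.range k, logSum K N h fun a => w' (a + j * N) := by
    refine Finset.sum_congr rfl fun j hj => dependsOn_logSum N h fun a ha => hw _ ?_
    have h1 := Finset.mem_Icc.1 (Finset.mem_coe.1 ha)
    have h2 := Nat.mul_le_mul_right N (Finset.mem_range.1 hj)
    rw [Nat.succ_mul] at h2
    rw [Finset.mem_Icc]
    omega
  simp only [goodBlocks, Set.mem_ofPred_eq, e]

/-- Force a renewal at the end of every block and use superadditivity. -/
lemma le_logSum_of_mem_goodBlocks (hK : IsRenewalWeight K) {N k : ℕ} {h z : ℝ} {w : ℕ → ℝ}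
    (hw : w ∈ goodBlocks K N k h z) : (k * N : ℕ) * z ≤ logSum K (k * N) h w := by
  refine le_trans hw ?_
  clear hw
  induction k with
  | zero => simp [logSum]
  | succ k ih =>
    rw [Finset.sum_range_succ]
    have := logSum_add_le hK (k * N) N h w
    rw [Nat.succ_mul]
    linarith

variable {μ : Measure ℝ} [IsProbabilityMeasure μ]

/-- Changing the law of the charges in a finite box by a density bounded by `exp D` on an event. -/
lemma measureReal_infinitePi_tilt_le {δ : ℝ} (h0 : 0 ≤ δ) (h1 : δ ≤ 1 / 2) {M : ℕ} {D : ℝ}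
    {E : Set (ℕ → ℝ)} (hEm : MeasurableSet E)
    (hEdep : DependsOn (E.indicator (1 : (ℕ → ℝ) → ENNReal)) (Finset.Icc 1 M))
    (hD : ∀ w ∈ E, ∑ a ∈ Finset.Icc 1 M, Real.log (tiltDensity μ δ (w a)) ≤ D) :
    (infinitePi fun _ => tilt μ δ).real E ≤ Real.exp D * (infinitePi fun _ => μ).real E := by
  have hprob : IsProbabilityMeasure (tilt μ δ) := isProbabilityMeasure_tilt h0 h1
  have hpos : ∀ x, 0 < tiltDensity μ δ x := fun x => by
    linarith [(tiltDensity_bounds (μ := μ) h0 h1 x).1]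
  have key : (infinitePi fun _ => tilt μ δ) E ≤
      ENNReal.ofReal (Real.exp D) * (infinitePi fun _ => μ) E := by
    rw [← lintegral_indicator_one hEm, ← lintegral_indicator_one hEm,
      ← lintegral_const_mul _ (measurable_one.indicator hEm)]
    have hprob' : IsProbabilityMeasure
        (μ.withDensity fun x => ENNReal.ofReal (tiltDensity μ δ x)) := hprob
    unfold tilt
    rw [lintegral_infinitePi_withDensity (measurable_tiltDensity δ).ennreal_ofReal
      (measurable_one.indicator hEm) hEdep]
    refine lintegral_mono fun w => ?_
    by_cases hw : w ∈ E
    · rw [Set.indicator_of_mem hw, Pi.one_apply, one_mul, mul_one,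
        ← ENNReal.ofReal_prod_of_nonneg fun a _ => (hpos (w a)).le]
      refine ENNReal.ofReal_le_ofReal ?_
      rw [← Real.log_le_iff_le_exp (Finset.prod_pos fun a _ => hpos (w a)),
        Real.log_prod fun a _ => (hpos (w a)).ne']
      exact hD w hw
    · rw [Set.indicator_of_notMem hw, zero_mul]
      exact zero_le
  have h2 := ENNReal.toReal_mono (ENNReal.mul_ne_top ENNReal.ofReal_ne_top
    (measure_ne_top _ _)) key
  rwa [ENNReal.toReal_mul, ENNReal.toReal_ofReal (Real.exp_pos D).le] at h2

/-- Good blocks are not too rare: their probability is at least the exponential of minus the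
entropic cost of the tilt. -/
lemma eventually_le_measureReal_goodBlocks (hK : IsRenewalWeight K)
    (hμ : Integrable (fun x => x) μ) {δ : ℝ} (h0 : 0 ≤ δ) (h1 : δ ≤ 1 / 2) {N : ℕ} (hN : 1 ≤ N)
    {h y ε : ℝ} (hε : 0 < ε) (hy : N * y ≤ meanLogSum K (tilt μ δ) N h) :
    ∀ᶠ k : ℕ in atTop, 1 / 2 * Real.exp (-((k * N : ℕ) * (δ ^ 2 + ε))) ≤
      (infinitePi fun _ => μ).real (goodBlocks K N k h (y - ε)) := by
  have hprob : IsProbabilityMeasure (tilt μ δ) := isProbabilityMeasure_tilt h0 h1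
  have hN' : (0 : ℝ) < N := by exact_mod_cast hN
  set L : ℝ → ℝ := fun x => Real.log (tiltDensity μ δ x) with hL
  have hLm : Measurable L := Real.measurable_log.comp (measurable_tiltDensity δ)
  have hLi : Integrable L (tilt μ δ) := by
    refine Integrable.of_bound hLm.aestronglyMeasurable (|Real.log (1 / 2)| + |Real.log (3 / 2)|)
      (ae_of_all _ fun x => ?_)
    have hb := tiltDensity_bounds (μ := μ) h0 h1 x
    have h2 := Real.log_le_log (by norm_num) hb.1
    have h3 := Real.log_le_log (by linarith [hb.1]) hb.2
    rw [Real.norm_eq_abs, abs_le]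
    constructor
    · linarith [neg_abs_le (Real.log (1 / 2)), abs_nonneg (Real.log (3 / 2))]
    · linarith [le_abs_self (Real.log (3 / 2)), abs_nonneg (Real.log (1 / 2))]
  have slln1 := block_strong_law (measurable_logSum N h)
    (integrable_logSum hK (integrable_tilt h0 h1 hμ) N h) (dependsOn_logSum N h)
  have slln2 := block_strong_law (μ := tilt μ δ) (N := 1) (F := fun w => L (w 1))
    (hLm.comp (measurable_pi_apply 1)) (integral_eval 1 hLi).1 fun x y hxy => by
      dsimp only
      rw [hxy 1 (by simp)]
  rw [(integral_eval 1 hLi).2] at slln2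
  have hent : ∫ x, L x ∂tilt μ δ ≤ δ ^ 2 := integral_log_tiltDensity_le h0 h1
  -- Good blocks whose log-likelihood ratio is also at most its typical size. By the law of large
  -- numbers both properties hold eventually under the tilted law, so `E k` has tilted probability
  -- tending to one; the second bounds the cost of returning to `μ`.
  set E : ℕ → Set (ℕ → ℝ) := fun k => goodBlocks K N k h (y - ε) ∩
    {w | ∑ a ∈ Finset.Icc 1 (k * N), L (w a) ≤ (k * N : ℕ) * (δ ^ 2 + ε)} with hE
  have hEm : ∀ k, MeasurableSet (E k) := fun k => (measurableSet_goodBlocks _ _ _ _).inter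
    (measurableSet_le (Finset.measurable_fun_sum _ fun a _ => hLm.comp (measurable_pi_apply a))
      measurable_const)
  have hev : ∀ᵐ w ∂(infinitePi fun _ => tilt μ δ), ∀ᶠ k in atTop, w ∈ E k := by
    filter_upwards [slln1, slln2] with w hw1 hw2
    have h2 : N * (y - ε) < ∫ w, logSum K N h w ∂(infinitePi fun _ => tilt μ δ) := by
      refine lt_of_lt_of_le ?_ hy
      nlinarith
    have e1 := hw1.eventually_const_lt h2
    have e2 := (hw2.comp (tendsto_id.atTop_mul_const' hN)).eventually_lt_const
      (show ∫ x, L x ∂tilt μ δ < δ ^ 2 + ε by linarith)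
    filter_upwards [e1, e2, eventually_gt_atTop 0] with k e1 e2 hk
    have hk' : (0 : ℝ) < k := by exact_mod_cast hk
    constructor
    · rw [lt_div_iff₀ hk'] at e1
      simp only [goodBlocks, Set.mem_ofPred_eq]
      push_cast
      linarith
    · simp only [Function.comp_apply, id, mul_one] at e2
      have hkN : (0 : ℝ) < (k * N : ℕ) := by exact_mod_cast Nat.mul_pos hk hN
      rw [div_lt_iff₀ hkN] at e2
      rw [Set.mem_ofPred_eq, sum_Icc_one_eq_sum_range]
      simp only [add_comm 1] at e2
      linarith
  have htend : Tendsto (fun k => (infinitePi fun _ => tilt μ δ) (E k)) atTop (𝓝 1) := by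
    have := tendsto_measure_of_ae_tendsto_indicator_of_isFiniteMeasure atTop
      (μ := infinitePi fun _ => tilt μ δ) (A := Set.univ) (As := E) MeasurableSet.univ hEm
      (hev.mono fun w hw => hw.mono fun k hk => by simpa using hk)
    simpa using this
  filter_upwards [htend.eventually_const_lt (show (1 / 2 : ENNReal) < 1 by
    exact ENNReal.half_lt_self one_ne_zero ENNReal.one_ne_top)] with k hk
  have h2 : (1 / 2 : ℝ) ≤ (infinitePi fun _ => tilt μ δ).real (E k) := by
    rw [Measure.real]
    have := ENNReal.toReal_mono (measure_ne_top _ _) hk.le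
    simpa using this
  have h3 := measureReal_infinitePi_tilt_le h0 h1 (M := k * N) (hEm k)
    (dependsOn_indicator fun w w' hww => and_congr (dependsOn_goodBlocks N k h (y - ε) hww) (by
      simp only [Set.mem_ofPred_eq]
      rw [Finset.sum_congr rfl fun a ha => by rw [hww a ha]])) fun w hw => hw.2
  have h4 : (infinitePi fun _ => μ).real (E k) ≤
      (infinitePi fun _ => μ).real (goodBlocks K N k h (y - ε)) :=
    measureReal_mono Set.inter_subset_left
  rw [Real.exp_neg]
  have h5 := Real.exp_pos ((k * N : ℕ) * (δ ^ 2 + ε))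
  rw [← div_eq_mul_inv, div_le_iff₀ h5]
  nlinarith

end goodBlocks

/-! ### The smoothing inequality -/

section smoothing

open Measure

/-- Turns an increase of the reward into a change of the law of the charges, so that it can be
compared with the tilt coordinate by coordinate. -/
lemma meanLogSum_map_add {K : ℕ → ℝ} {μ : Measure ℝ} [IsProbabilityMeasure μ] (n : ℕ)
    (h s : ℝ) :
    meanLogSum K (μ.map fun x => x + s) n h = meanLogSum K μ n (h + s) := by
  have h1 := infinitePi_map_pi (fun _ : ℕ => μ) (f := fun _ x => x + s)
    fun _ => measurable_add_const s
  rw [meanLogSum, ← h1, integral_map (measurable_pi_lambda _ fun a =>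
    (measurable_pi_apply a).add_const s).aemeasurable (measurable_logSum n h).aestronglyMeasurable]
  refine integral_congr_ae (ae_of_all _ fun w => ?_)
  simp only [logSum]
  rw [show (fun a => h + (w a + s)) = fun a => h + s + w a from funext fun a => by ring]

variable {K : ℕ → ℝ} (hK : IsRenewalWeight K) {μ : Measure ℝ} [IsProbabilityMeasure μ]
  (hμ : Integrable (fun x => x) μ)

include hK

lemma exists_logSum_update_eq (n : ℕ) (h : ℝ) (w : ℕ → ℝ) (i : ℕ) :
    ∃ A B : ℝ, 0 ≤ A ∧ 0 ≤ B ∧ 0 < A + B ∧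
      ∀ x, logSum K n h (Function.update w i x) = Real.log (A + B * Real.exp x) := by
  obtain ⟨A, B, hA, hB, e⟩ := exists_renewalSum_update_eq hK.nonneg n (fun a => h + w a) i
  have e1 : ∀ x, renewalSum K n (fun a => h + Function.update w i x a) =
      A + B * Real.exp h * Real.exp x := by
    intro x
    rw [mul_assoc, ← Real.exp_add, ← e]
    congr 1
    ext a
    by_cases ha : a = i
    · subst ha
      simp
    · simp [Function.update_of_ne ha]
  refine ⟨A, B * Real.exp h, hA, mul_nonneg hB (Real.exp_pos h).le, ?_, fun x => by
    rw [logSum, e1]⟩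
  have := renewalSum_pos hK.nonneg hK.pos n fun a => h + Function.update w i 0 a
  rwa [e1, Real.exp_zero, mul_one] at this

include hμ

/-- A tilt of the law of the charges dominates a small increase of the pinning reward. -/
lemma exists_meanLogSum_shift_le (hmean : ∫ x, x ∂μ = 0) (hvar : 0 < ∫ x, x ^ 2 ∂μ) :
    ∃ c, 0 < c ∧ ∀ δ, 0 ≤ δ → δ ≤ 1 / 2 → ∀ (n : ℕ) (h : ℝ),
      meanLogSum K μ n (h + c * δ) ≤ meanLogSum K (tilt μ δ) n h := by
  obtain ⟨c, hc, hcomp⟩ := exists_integral_log_shift_le hμ hmean hvar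
  refine ⟨c, hc, fun δ h0 h1 n h => ?_⟩
  have hprob : IsProbabilityMeasure (tilt μ δ) := isProbabilityMeasure_tilt h0 h1
  have hm : Measurable fun x : ℝ => x + c * δ := measurable_add_const _
  have hprob' : IsProbabilityMeasure (μ.map fun x => x + c * δ) :=
    isProbabilityMeasure_map hm.aemeasurable
  rw [← meanLogSum_map_add]
  refine integral_infinitePi_le ?_ (integrable_tilt h0 h1 hμ) (measurable_logSum n h)
    (abs_logSum_le hK n h) (dependsOn_logSum n h) fun w i _ => ?_
  · exact (integrable_map_measure measurable_id.aestronglyMeasurable hm.aemeasurable).2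
      (hμ.add (integrable_const _))
  · obtain ⟨A, B, hA, hB, hAB, e⟩ := exists_logSum_update_eq hK n h w i
    simp only [e]
    have hg : Measurable fun x => Real.log (A + B * Real.exp x) :=
      Real.measurable_log.comp ((Real.measurable_exp.const_mul B).const_add A)
    rw [integral_map hm.aemeasurable hg.aestronglyMeasurable]
    exact hcomp δ h0 h1 A B hA hB hAB

variable {C : ℝ} (hC : 0 ≤ C)
  (hKlog : ∀ t : ℕ, 1 ≤ t → -(C * (1 + Real.log t)) ≤ Real.log (K t))

include hC hKlog

/-- If the free energy is not positive for the reward `h`, then the growth rates of the partition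
functions under a tilt of the charges are at most quadratic in the tilt. -/
lemma growth_le_of_tilt {h : ℝ} (hneg : ∀ n, meanLogSum K μ n h ≤ 0) {δ : ℝ} (h0 : 0 < δ)
    (h1 : δ ≤ 1 / 2) {N : ℕ} (hN : 1 ≤ N) {y : ℝ}
    (hy : N * y ≤ meanLogSum K (tilt μ δ) N h) : y ≤ (1 + 2 * C) * δ ^ 2 := by
  -- The precision `ε` of the good-block estimate is taken to be `δ²`, so that `y - δ² ≤ 2Cδ²` in
  -- the limit.
  have hε : 0 < δ ^ 2 := by positivity
  set D := C * Real.log 2 + (2 * C + |h| + ∫ x, |x| ∂μ) with hD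
  -- This is `rare_stretch_bound` divided by the stretch length `M = k * N`; the terms in `log M /
  -- M` and `1 / M` vanish as `k → ∞`.
  have hev : ∀ᶠ k : ℕ in atTop, y - δ ^ 2 ≤ C * (δ ^ 2 + δ ^ 2) +
      (C * (Real.log (k * N : ℕ) / (k * N : ℕ)) + D * ((k * N : ℕ) : ℝ)⁻¹) := by
    filter_upwards [eventually_le_measureReal_goodBlocks hK hμ h0.le h1 hN hε hy,
      eventually_ge_atTop 1] with k hk hk1
    have hM : 1 ≤ k * N := Nat.mul_pos hk1 hN
    set M := k * N with hMdef
    have hM' : (0 : ℝ) < M := by exact_mod_cast hM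
    set p := (infinitePi fun _ => μ).real (goodBlocks K N k h (y - δ ^ 2)) with hp
    have hlow : 0 < 1 / 2 * Real.exp (-(M * (δ ^ 2 + δ ^ 2))) := by positivity
    have hp0 : 0 < p := hlow.trans_le hk
    have h2 := rare_stretch_bound hK hC hKlog hμ hneg hM (measurableSet_goodBlocks N k h _)
      (dependsOn_indicator fun w w' hw => dependsOn_goodBlocks N k h _ hw)
      (fun w hw => le_logSum_of_mem_goodBlocks hK hw) hp0
    have h3 : Real.log p⁻¹ ≤ Real.log 2 + M * (δ ^ 2 + δ ^ 2) := by
      have h4 := Real.log_le_log hlow hk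
      rw [Real.log_mul (by norm_num) (Real.exp_pos _).ne', Real.log_exp, one_div,
        Real.log_inv] at h4
      rw [Real.log_inv]
      linarith
    have h5 := mul_le_mul_of_nonneg_left h3 hC
    have h6 : M * (y - δ ^ 2) ≤ M * (C * (δ ^ 2 + δ ^ 2) +
        (C * (Real.log M / M) + D * (M : ℝ)⁻¹)) := by
      have e : M * (C * (δ ^ 2 + δ ^ 2) + (C * (Real.log M / M) + D * (M : ℝ)⁻¹)) =
          M * (C * (δ ^ 2 + δ ^ 2)) + C * Real.log M + D := by
        field_simp
        ring
      rw [e]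
      linarith
    exact le_of_mul_le_mul_left h6 hM'
  have hMt : Tendsto (fun k : ℕ => ((k * N : ℕ) : ℝ)) atTop atTop :=
    tendsto_natCast_atTop_atTop.comp (tendsto_id.atTop_mul_const' hN)
  have hlim := ((((Real.isLittleO_log_id_atTop.tendsto_div_nhds_zero.comp hMt).const_mul C).add
    ((tendsto_inv_atTop_zero.comp hMt).const_mul D)).const_add (C * (δ ^ 2 + δ ^ 2)))
  have := ge_of_tendsto hlim hev
  simp only [mul_zero, add_zero] at this
  linarith

/-- The smoothing inequality at a point where the free energy is not positive. -/
lemma exists_smoothing (hmean : ∫ x, x ∂μ = 0) (hvar : 0 < ∫ x, x ^ 2 ∂μ) {h : ℝ}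
    (hneg : ∀ n, meanLogSum K μ n h ≤ 0) {f : ℝ → ℝ}
    (hf : ∀ h, Tendsto (fun n : ℕ => 1 / (n : ℝ) * meanLogSum K μ n h) atTop (𝓝 (f h))) :
    ∃ c, 0 < c ∧ ∀ᶠ δ in 𝓝[>] (0 : ℝ), f (h + δ) ≤ c * δ ^ 2 := by
  obtain ⟨b, hb, hcomp⟩ := exists_meanLogSum_shift_le hK hμ hmean hvar
  -- A shift `δ' = b * δ` corresponds to the tilt `δ`, whence the factor `1 / b ^ 2`. The extra `1`
  -- pays for approximating `f` within `δ²` at a finite `N`.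
  refine ⟨(1 + 2 * C + 1) / b ^ 2, by positivity, ?_⟩
  filter_upwards [Ioc_mem_nhdsGT (show 0 < b / 2 by positivity)] with δ' hδ'
  obtain ⟨δ, rfl⟩ : ∃ δ, δ' = b * δ := ⟨δ' / b, by field_simp⟩
  have h0 : 0 < δ := pos_of_mul_pos_right hδ'.1 hb.le
  have h1 : δ ≤ 1 / 2 := le_of_mul_le_mul_left (by linarith [hδ'.2]) hb
  have hδ2 : 0 < δ ^ 2 := by positivity
  obtain ⟨N, hN, hN1⟩ := (((hf (h + b * δ)).eventually_const_lt
    (sub_lt_self (f (h + b * δ)) hδ2)).and (eventually_ge_atTop 1)).exists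
  have hN' : (0 : ℝ) < N := by exact_mod_cast hN1
  rw [one_div, inv_mul_eq_div, lt_div_iff₀ hN'] at hN
  have h2 := growth_le_of_tilt hK hμ hC hKlog hneg h0 h1 hN1 (y := f (h + b * δ) - δ ^ 2)
    ((mul_comm _ _).trans_le (hN.le.trans (hcomp δ h0.le h1 N h)))
  rw [mul_pow, ← mul_assoc, div_mul_cancel₀ _ (by positivity)]
  linarith

end smoothing

/-! ### The critical point -/

section critical

/-- Below the infimum `f` is nonpositive, and moving up by `s` raises it by at most `s`; letting `s
→ 0` gives `f hc ≤ 0`. The point `h₁` rules out the value `⊤`. -/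
lemma exists_coe_eq_sInf {f : ℝ → ℝ} (hbot : ⊥ < sInf ((fun h : ℝ => (h : EReal)) '' {h | 0 < f h}))
    {h₁ : ℝ} (h₁pos : 0 < f h₁) (hlip : ∀ h s, 0 ≤ s → f (h + s) ≤ s + f h) :
    ∃ hc : ℝ, (hc : EReal) = sInf ((fun h : ℝ => (h : EReal)) '' {h | 0 < f h}) ∧ f hc ≤ 0 := by
  set c := sInf ((fun h : ℝ => (h : EReal)) '' {h | 0 < f h}) with hc
  have hle : ∀ h, 0 < f h → c ≤ h := fun h hpos =>
    sInf_le (Set.mem_image_of_mem (fun h : ℝ => (h : EReal)) (Set.mem_ofPred_eq ▸ hpos))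
  have htop : c ≠ ⊤ := ((hle h₁ h₁pos).trans_lt (EReal.coe_lt_top h₁)).ne
  have e := EReal.coe_toReal htop hbot.ne'
  refine ⟨c.toReal, e, ?_⟩
  have hlow : ∀ h < c.toReal, f h ≤ 0 := by
    intro h hh
    by_contra! hpos
    have h1 := hle h hpos
    rw [← e, EReal.coe_le_coe_iff] at h1
    linarith
  refine le_of_forall_pos_le_add fun s hs => ?_
  have h1 := hlip (c.toReal - s) s hs.le
  rw [sub_add_cancel] at h1
  have h2 := hlow (c.toReal - s) (by linarith)
  linarith

end critical

end Pinning

/-! ### The main theorem: transfer to the canonical product space -/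

theorem theorem1p3
    {S Ω : Type*} [MeasurableSpace S] [MeasurableSpace Ω]
    -- the inter-arrival times: i.i.d., with values in `{1, 2, …}`
    (P : Measure S) [IsProbabilityMeasure P] (T : ℕ → S → ℕ)
    (hTmeas : ∀ i, Measurable (T i))
    (hTpos : ∀ i s, 1 ≤ T i s)
    (hTindep : iIndepFun T P)
    (hTident : ∀ i, IdentDistrib (T i) (T 0) P P)
    -- their common law is regularly varying and charges every positive integer
    (α : ℝ) (hα : 1 ≤ α) (ℓ : ℝ → ℝ) (hℓ : Pinning.SlowlyVarying ℓ)
    (hTlaw : ∀ t : ℕ, 1 ≤ t →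
      P.real {s | T 0 s = t} = ℓ t / (t : ℝ) ^ (α + 1) ∧ 0 < P.real {s | T 0 s = t})
    -- the charges: i.i.d., with some exponential moment, centered, not almost surely zero
    (Q : Measure Ω) [IsProbabilityMeasure Q] (ω : ℕ → Ω → ℝ)
    (hωmeas : ∀ a, Measurable (ω a))
    (hωindep : iIndepFun ω Q)
    (hωident : ∀ a, IdentDistrib (ω a) (ω 0) Q Q)
    (hωexp : ∃ η : ℝ, 0 < η ∧ Integrable (fun x => Real.exp (η * |ω 0 x|)) Q)
    (hωmean : ∫ x, ω 0 x ∂Q = 0)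
    (hωvar : 0 < ∫ x, (ω 0 x) ^ 2 ∂Q) :
    -- the free energy is well defined
    (∀ h : ℝ, (∀ n : ℕ, Integrable (Pinning.freeEnergyAt P T ω n h) Q) ∧
      Tendsto (fun n : ℕ => ∫ x, Pinning.freeEnergyAt P T ω n h x ∂Q) atTop
        (𝓝 (Pinning.freeEnergy P T Q ω h))) ∧
    -- the smoothing inequality
    (⊥ < Pinning.criticalPoint P T Q ω →
      ∃ hc : ℝ, (hc : EReal) = Pinning.criticalPoint P T Q ω ∧
        ∃ c : ℝ, 0 < c ∧ ∀ᶠ δ in 𝓝[>] (0 : ℝ), Pinning.freeEnergy P T Q ω (hc + δ) ≤ c * δ ^ 2) := by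
  set K : ℕ → ℝ := fun t => P.real {s | T 0 s = t} with hKdef
  set μ : Measure ℝ := Q.map (ω 0) with hμdef
  have hprob : IsProbabilityMeasure μ := Measure.isProbabilityMeasure_map (hωmeas 0).aemeasurable
  have hK : Pinning.IsRenewalWeight K :=
    ⟨fun t => measureReal_nonneg, fun t ht => (hTlaw t ht).2,
      Pinning.sum_measureReal_le_one (hTmeas 0)⟩
  obtain ⟨C, hC, hKlog⟩ := hℓ.exists_le_log (K := K) hTlaw
  have hω0 : Integrable (ω 0) Q := by
    obtain ⟨η, hη, hint⟩ := hωexp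
    refine (hint.const_mul η⁻¹).mono' (hωmeas 0).aestronglyMeasurable (ae_of_all _ fun x => ?_)
    rw [Real.norm_eq_abs, inv_mul_eq_div, le_div_iff₀ hη]
    linarith [Real.add_one_le_exp (η * |ω 0 x|)]
  have hμ : Integrable (fun x => x) μ :=
    (integrable_map_measure measurable_id.aestronglyMeasurable (hωmeas 0).aemeasurable).2 hω0
  have hmean : ∫ x, x ∂μ = 0 :=
    (integral_map (hωmeas 0).aemeasurable measurable_id.aestronglyMeasurable).trans hωmean
  have hvar : 0 < ∫ x, x ^ 2 ∂μ :=
    hωvar.trans_eq (integral_map (hωmeas 0).aemeasurable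
      (measurable_id.pow_const 2).aestronglyMeasurable).symm
  have hjoint : Q.map (fun x a => ω a x) = Measure.infinitePi fun _ => μ := by
    rw [hωindep.map_fun_eq_infinitePi_map hωmeas]
    congr 1
    ext1 a
    exact (hωident a).map_eq
  have hωm : Measurable fun x a => ω a x := measurable_pi_lambda _ hωmeas
  have hFE : ∀ n h x, Pinning.freeEnergyAt P T ω n h x =
      1 / (n : ℝ) * Pinning.logSum K n h fun a => ω a x := fun n h x => by
    rw [Pinning.freeEnergyAt, Pinning.partitionFunction_eq hTmeas hTpos hTindep hTident]
    rfl
  have hFEint : ∀ n h, ∫ x, Pinning.freeEnergyAt P T ω n h x ∂Q =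
      1 / (n : ℝ) * Pinning.meanLogSum K μ n h := fun n h => by
    simp only [hFE]
    rw [integral_const_mul, Pinning.meanLogSum, ← hjoint, integral_map hωm.aemeasurable
      (Pinning.measurable_logSum n h).aestronglyMeasurable]
  have hlim : ∀ h, Tendsto (fun n : ℕ => 1 / (n : ℝ) * Pinning.meanLogSum K μ n h) atTop
      (𝓝 (Pinning.freeEnergy P T Q ω h)) := fun h => by
    obtain ⟨f, hf, -⟩ := Pinning.exists_tendsto_meanLogSum hK hμ h
    simp only [Pinning.freeEnergy, hFEint]
    exact tendsto_nhds_limUnder ⟨f, hf⟩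
  refine ⟨fun h => ⟨fun n => ?_, by simpa only [hFEint] using hlim h⟩, fun hbot => ?_⟩
  · simp only [funext (hFE n h)]
    refine Integrable.const_mul ?_ _
    have h1 := Pinning.integrable_logSum hK hμ n h
    rw [← hjoint, integrable_map_measure (Pinning.measurable_logSum n h).aestronglyMeasurable
      hωm.aemeasurable] at h1
    exact h1
  -- At `h₁ = 1 - log K(1)`, visiting every site gives free energy at least `log K(1) + h₁ = 1`.
  · obtain ⟨hc, hc_eq, hc_le⟩ := Pinning.exists_coe_eq_sInf hbot (h₁ := 1 - Real.log (K 1))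
      (zero_lt_one.trans_le (ge_of_tendsto (hlim _) ((eventually_ge_atTop 1).mono fun n hn => by
        have hn' : (0 : ℝ) < n := by exact_mod_cast hn
        have h1 := Pinning.le_meanLogSum hK hμ hmean n (1 - Real.log (K 1))
        rw [one_div, inv_mul_eq_div, le_div_iff₀ hn']
        linarith)))
      fun h s hs => le_of_tendsto_of_tendsto (hlim (h + s)) ((hlim h).const_add s)
        ((eventually_ge_atTop 1).mono fun n hn => by
          have hn' : (0 : ℝ) < n := by exact_mod_cast hn
          have h1 := Pinning.meanLogSum_add_const_le hK hμ n h hs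
          dsimp only
          rw [one_div, inv_mul_eq_div, inv_mul_eq_div, div_le_iff₀ hn', add_mul,
            div_mul_cancel₀ _ hn'.ne']
          linarith)
    refine ⟨hc, hc_eq, Pinning.exists_smoothing hK hμ hC hKlog hmean hvar (fun n => ?_) hlim⟩
    -- The free energy is an upper bound for all finite-volume values, so `f(h_c) ≤ 0` makes every
    -- quenched mean nonpositive.
    obtain ⟨f, hf, hle⟩ := Pinning.exists_tendsto_meanLogSum hK hμ hc
    rw [tendsto_nhds_unique hf (hlim hc)] at hle
    exact (hle n).trans (mul_nonpos_of_nonneg_of_nonpos n.cast_nonneg hc_le)
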